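/- Let $\mathfrak{g}=\mathfrak{sl}_2(\mathbb{C})$ with standard basis $e,h,f$, let $\mathfrak{T}=\mathfrak{sl}_2\otimes\mathbb{C}[x]/(x^2)$ be the associated Takiff Lie algebra with bracket $[v\otimes x^i,w\otimes x^j]=[v,w]\otimes x^{i+j}$, and write $v=v\otimes 1$, $\bar v=v\otimes x$ for $v\in\mathfrak{sl}_2$. Let $U=U(\mathfrak{T})$, let $Z(\mathfrak{T})$ be the centre of $U$, and let $$C=\bar h h+2\bar f e+2\bar e f,\qquad \bar C=\bar h^2+4\bar f\bar e ,$$ which are elements of $Z(\mathfrak{T})$. For $\lambda_1,\lambda_2\in\mathbb{C}$ let $\Delta(\lambda_1,\lambda_2)$ be the Verma module, i.e. the $U$-module induced from the one-dimensional module of the subalgebra spanned by $h,\bar h,e,\bar e$ on which $e,\bar e$ act by $0$, $h$ by $\lambda_1$ and $\bar h$ by $\lambda_2$. Let $U_{(f)}$ be the Ore localization of $U$ at the powers of $f$, let $S_f=U_{(f)}/U$ (a $U$-$U$-bimodule), and for $n\in\mathbb{Z}$, $\lambda_2\neq0$ let $$V(n,\lambda_2)=\{m\in S_f\otimes_U\Delta(n-2,\lambda_2)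 : \dim \mathbb{C}[e]m<\infty\},$$ a $U$-submodule of $S_f\otimes_U\Delta(n-2,\lambda_2)$. Theorem. Let $n\in\mathbb{Z}$ and $\lambda_2\in\mathbb{C}\setminus\{0\}$. Then $$\operatorname{Ann}_U V(n,\lambda_2)=\operatorname{Ann}_U\Delta(n-2,\lambda_2)=\operatorname{Ann}_U\Delta(-n-2,-\lambda_2).$$ There is a unique homomorphism of $\mathbb{C}$-algebras $\chi\colon Z(\mathfrak{T})\to\mathbb{C}$ with $\chi(C)=n\lambda_2$ and $\chi(\bar C)=\lambda_2^2$, and the above annihilator is the centrally generated ideal $$U\cdot\operatorname{Ker}\chi = U\,(C-n\lambda_2)+U\,(\bar C-\lambda_2^2).$$ -/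

import Mathlib

open scoped TensorProduct
open LieAlgebra.SpecialLinear (sl)

noncomputable section

namespace TakiffSl2

/-! ### The Takiff Lie algebra of `sl₂` -/

/-- The Lie algebra `sl₂` over `ℂ`. -/
abbrev Sl2 : Type := sl (Fin 2) ℂ

/-- The Takiff Lie algebra `𝔻 ⊗ sl₂`, where `𝔻 = ℂ[x]/(x²)`, as a complex Lie algebra with
bracket `[a ⊗ v, b ⊗ w] = ab ⊗ [v, w]`. -/
def T : Type := DualNumber ℂ ⊗[ℂ] Sl2

instance lieRingT : LieRing T := inferInstanceAs (LieRing (DualNumber ℂ ⊗[ℂ] Sl2))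
instance lieAlgebraT : LieAlgebra ℂ T := inferInstanceAs (LieAlgebra ℂ (DualNumber ℂ ⊗[ℂ] Sl2))

/-- The standard basis of `sl₂`. -/
def e₀ : Sl2 := ⟨!![0, 1; 0, 0], by simp [sl, Matrix.trace_fin_two]⟩
def f₀ : Sl2 := ⟨!![0, 0; 1, 0], by simp [sl, Matrix.trace_fin_two]⟩
def h₀ : Sl2 := ⟨!![1, 0; 0, -1], by simp [sl, Matrix.trace_fin_two]⟩

/-- The copy of `v ∈ sl₂` in the Takiff algebra. -/
def unbar (v : Sl2) : T := (1 : DualNumber ℂ) ⊗ₜ[ℂ] v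

/-- The element `v̄` of the Takiff algebra, for `v ∈ sl₂`. -/
def bar (v : Sl2) : T := (DualNumber.eps : DualNumber ℂ) ⊗ₜ[ℂ] v

lemma lie_ef : ⁅e₀, f₀⁆ = h₀ := by
  apply Subtype.ext
  rw [LieAlgebra.SpecialLinear.sl_bracket]
  ext i j; fin_cases i <;> fin_cases j <;> simp [e₀, f₀, h₀]

lemma lie_he : ⁅h₀, e₀⁆ = (2 : ℂ) • e₀ := by
  apply Subtype.ext
  rw [LieAlgebra.SpecialLinear.sl_bracket]
  ext i j; fin_cases i <;> fin_cases j <;> simp [e₀, h₀] <;> norm_num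

lemma lie_hf : ⁅h₀, f₀⁆ = (-2 : ℂ) • f₀ := by
  apply Subtype.ext
  rw [LieAlgebra.SpecialLinear.sl_bracket]
  ext i j; fin_cases i <;> fin_cases j <;> simp [f₀, h₀] <;> norm_num

lemma tmul_lie_tmul (a b : DualNumber ℂ) (v w : Sl2) :
    ⁅(a ⊗ₜ[ℂ] v : DualNumber ℂ ⊗[ℂ] Sl2), (b ⊗ₜ[ℂ] w : DualNumber ℂ ⊗[ℂ] Sl2)⁆ =
      (a * b) ⊗ₜ[ℂ] ⁅v, w⁆ := by
  simp

lemma lie_unbar_unbar (v w : Sl2) : ⁅unbar v, unbar w⁆ = unbar ⁅v, w⁆ :=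
  (tmul_lie_tmul 1 1 v w).trans (by rw [one_mul]; rfl)

lemma lie_unbar_bar (v w : Sl2) : ⁅unbar v, bar w⁆ = bar ⁅v, w⁆ :=
  (tmul_lie_tmul 1 DualNumber.eps v w).trans (by rw [one_mul]; rfl)

lemma lie_bar_bar (v w : Sl2) : ⁅bar v, bar w⁆ = 0 :=
  (tmul_lie_tmul DualNumber.eps DualNumber.eps v w).trans
    (by rw [DualNumber.eps_mul_eps, TensorProduct.zero_tmul]; rfl)

lemma bar_add (v w : Sl2) : bar (v + w) = bar v + bar w := TensorProduct.tmul_add _ _ _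
lemma unbar_add (v w : Sl2) : unbar (v + w) = unbar v + unbar w := TensorProduct.tmul_add _ _ _
lemma bar_smul (c : ℂ) (v : Sl2) : bar (c • v) = c • bar v := TensorProduct.tmul_smul _ _ _
lemma unbar_smul (c : ℂ) (v : Sl2) : unbar (c • v) = c • unbar v := TensorProduct.tmul_smul _ _ _
lemma bar_zero : bar 0 = 0 := TensorProduct.tmul_zero _ _
lemma unbar_zero : unbar 0 = 0 := TensorProduct.tmul_zero _ _

lemma sl2_eq (v : Sl2) : v = v.1 0 1 • e₀ + v.1 1 0 • f₀ + v.1 0 0 • h₀ := by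
  have hv : v.1 0 0 + v.1 1 1 = 0 := by
    have := v.2
    simpa [sl, Matrix.trace_fin_two] using this
  apply Subtype.ext
  ext i j
  fin_cases i <;> fin_cases j <;> simp [e₀, f₀, h₀]
  linear_combination hv

/-- Every element of the Takiff algebra is of the form `v + w̄`. -/
lemma exists_eq (x : T) : ∃ v w : Sl2, x = unbar v + bar w := by
  refine TensorProduct.induction_on (R := ℂ) (M := DualNumber ℂ) (N := Sl2)
    (motive := fun x => ∃ v w : Sl2, (x : T) = unbar v + bar w) x ?_ ?_ ?_
  · exact ⟨0, 0, by rw [unbar_zero, bar_zero, add_zero]; rfl⟩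
  · intro a v
    refine ⟨a.fst • v, a.snd • v, ?_⟩
    change a ⊗ₜ[ℂ] v = (1 : DualNumber ℂ) ⊗ₜ[ℂ] (a.fst • v) +
      (DualNumber.eps : DualNumber ℂ) ⊗ₜ[ℂ] (a.snd • v)
    rw [← TensorProduct.smul_tmul, ← TensorProduct.smul_tmul, ← TensorProduct.add_tmul]
    congr 1
    ext <;> simp
  · rintro x y ⟨v, w, hx⟩ ⟨v', w', hy⟩
    refine ⟨v + v', w + w', ?_⟩
    rw [unbar_add, bar_add, add_add_add_comm, ← hx, ← hy]
    rfl

/-! ### The universal enveloping algebra -/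

/-- The universal enveloping algebra of the Takiff algebra. -/
abbrev U : Type := UniversalEnvelopingAlgebra ℂ T

/-- The image in `U` of an element of the Takiff algebra. -/
def inc (x : T) : U := UniversalEnvelopingAlgebra.ι ℂ x

def e : U := inc (unbar e₀)
def f : U := inc (unbar f₀)
def h : U := inc (unbar h₀)
def eb : U := inc (bar e₀)
def fb : U := inc (bar f₀)
def hb : U := inc (bar h₀)

lemma inc_add (x y : T) : inc (x + y) = inc x + inc y := by simp [inc]
lemma inc_smul (c : ℂ) (x : T) : inc (c • x) = c • inc x := by simp [inc]
lemma inc_zero : inc 0 = 0 := by simp [inc]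

attribute [local instance 100] LieRing.ofAssociativeRing in
lemma inc_lie (x y : T) : inc x * inc y - inc y * inc x = inc ⁅x, y⁆ := by
  unfold inc
  rw [LieHom.map_lie, LieRing.of_associative_ring_bracket]

attribute [local instance 100] LieRing.ofAssociativeRing in
/-- The enveloping algebra is generated by the Lie algebra. -/
lemma adjoin_inc : Algebra.adjoin ℂ (Set.range inc) = ⊤ := by
  set A := Algebra.adjoin ℂ (Set.range inc) with hA
  let g : T →ₗ⁅ℂ⁆ A :=
    { toFun := fun x => ⟨inc x, Algebra.subset_adjoin ⟨x, rfl⟩⟩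
      map_add' := fun x y => Subtype.ext (inc_add x y)
      map_smul' := fun c x => Subtype.ext (inc_smul c x)
      map_lie' := fun {x y} => Subtype.ext (inc_lie x y).symm }
  have key : A.val.comp (UniversalEnvelopingAlgebra.lift ℂ g) = AlgHom.id ℂ U := by
    apply UniversalEnvelopingAlgebra.hom_ext
    ext x
    have : UniversalEnvelopingAlgebra.lift ℂ g (UniversalEnvelopingAlgebra.ι ℂ x) = g x :=
      UniversalEnvelopingAlgebra.lift_ι_apply ℂ g x
    simp only [LieHom.comp_apply, AlgHom.coe_toLieHom, AlgHom.comp_apply, this]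
    rfl
  rw [eq_top_iff]
  intro u _
  have : A.val (UniversalEnvelopingAlgebra.lift ℂ g u) = u := DFunLike.congr_fun key u
  rw [← this]
  exact Subtype.property _

lemma U_induction {P : U → Prop} (halg : ∀ c : ℂ, P (algebraMap ℂ U c)) (hinc : ∀ x, P (inc x))
    (hadd : ∀ u v, P u → P v → P (u + v)) (hmul : ∀ u v, P u → P v → P (u * v)) (u : U) : P u := by
  have hu : u ∈ Algebra.adjoin ℂ (Set.range inc) := by rw [adjoin_inc]; trivial
  induction hu using Algebra.adjoin_induction with
  | mem x hx => obtain ⟨y, rfl⟩ := hx; exact hinc y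
  | algebraMap r => exact halg r
  | add x y _ _ hx hy => exact hadd x y hx hy
  | mul x y _ _ hx hy => exact hmul x y hx hy

/-- Every element of the Takiff algebra is a combination of the standard basis. -/
lemma inc_eq (x : T) : ∃ a b c a' b' c' : ℂ,
    inc x = a • e + b • f + c • h + a' • eb + b' • fb + c' • hb := by
  obtain ⟨v, w, rfl⟩ := exists_eq x
  refine ⟨v.1 0 1, v.1 1 0, v.1 0 0, w.1 0 1, w.1 1 0, w.1 0 0, ?_⟩
  have h1 : inc (unbar v) = v.1 0 1 • e + v.1 1 0 • f + v.1 0 0 • h := by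
    conv_lhs => rw [sl2_eq v]
    simp only [unbar_add, unbar_smul, inc_add, inc_smul, e, f, h]
  have h2 : inc (bar w) = w.1 0 1 • eb + w.1 1 0 • fb + w.1 0 0 • hb := by
    conv_lhs => rw [sl2_eq w]
    simp only [bar_add, bar_smul, inc_add, inc_smul, eb, fb, hb]
  rw [inc_add, h1, h2]
  abel

lemma U_induction' {P : U → Prop} (halg : ∀ c : ℂ, P (algebraMap ℂ U c))
    (he : P e) (hf : P f) (hh : P h) (heb : P eb) (hfb : P fb) (hhb : P hb)
    (hadd : ∀ u v, P u → P v → P (u + v)) (hmul : ∀ u v, P u → P v → P (u * v)) (u : U) : P u := by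
  have hs : ∀ (c : ℂ) (u : U), P u → P (c • u) := fun c u hu => by
    rw [Algebra.smul_def]; exact hmul _ _ (halg c) hu
  refine U_induction halg (fun x => ?_) hadd hmul u
  obtain ⟨a, b, c, a', b', c', hx⟩ := inc_eq x
  rw [hx]
  exact hadd _ _ (hadd _ _ (hadd _ _ (hadd _ _ (hadd _ _ (hs _ _ he) (hs _ _ hf)) (hs _ _ hh))
    (hs _ _ heb)) (hs _ _ hfb)) (hs _ _ hhb)

/-! Commutation relations between the generators of `U`. -/

lemma two_smul' (u : U) : (2 : ℂ) • u = 2 * u := by rw [two_smul, two_mul]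
lemma neg_two_smul' (u : U) : (-2 : ℂ) • u = -(2 * u) := by rw [neg_smul, two_smul']

lemma comm_ef : e * f = f * e + h := by
  have := inc_lie (unbar e₀) (unbar f₀)
  rw [lie_unbar_unbar, lie_ef] at this
  exact sub_eq_iff_eq_add'.1 this

lemma comm_he : h * e = e * h + 2 * e := by
  have := inc_lie (unbar h₀) (unbar e₀)
  rw [lie_unbar_unbar, lie_he, unbar_smul, inc_smul, two_smul'] at this
  exact sub_eq_iff_eq_add'.1 this

lemma comm_hf : h * f = f * h - 2 * f := by
  have := inc_lie (unbar h₀) (unbar f₀)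
  rw [lie_unbar_unbar, lie_hf, unbar_smul, inc_smul, neg_two_smul'] at this
  rw [sub_eq_add_neg]
  exact sub_eq_iff_eq_add'.1 this

lemma comm_e_eb : e * eb = eb * e := by
  have := inc_lie (unbar e₀) (bar e₀)
  rw [lie_unbar_bar, lie_self, bar_zero, inc_zero] at this
  exact sub_eq_zero.1 this

lemma comm_f_fb : f * fb = fb * f := by
  have := inc_lie (unbar f₀) (bar f₀)
  rw [lie_unbar_bar, lie_self, bar_zero, inc_zero] at this
  exact sub_eq_zero.1 this

lemma comm_h_hb : h * hb = hb * h := by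
  have := inc_lie (unbar h₀) (bar h₀)
  rw [lie_unbar_bar, lie_self, bar_zero, inc_zero] at this
  exact sub_eq_zero.1 this

lemma comm_e_fb : e * fb = fb * e + hb := by
  have := inc_lie (unbar e₀) (bar f₀)
  rw [lie_unbar_bar, lie_ef] at this
  exact sub_eq_iff_eq_add'.1 this

lemma comm_f_eb : f * eb = eb * f - hb := by
  have := inc_lie (unbar f₀) (bar e₀)
  rw [lie_unbar_bar, ← lie_skew, lie_ef, ← neg_one_smul ℂ, bar_smul,
    inc_smul, neg_one_smul] at this
  rw [sub_eq_add_neg]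
  exact sub_eq_iff_eq_add'.1 this

lemma comm_h_eb : h * eb = eb * h + 2 * eb := by
  have := inc_lie (unbar h₀) (bar e₀)
  rw [lie_unbar_bar, lie_he, bar_smul, inc_smul, two_smul'] at this
  exact sub_eq_iff_eq_add'.1 this

lemma comm_h_fb : h * fb = fb * h - 2 * fb := by
  have := inc_lie (unbar h₀) (bar f₀)
  rw [lie_unbar_bar, lie_hf, bar_smul, inc_smul, neg_two_smul'] at this
  rw [sub_eq_add_neg]
  exact sub_eq_iff_eq_add'.1 this

lemma comm_e_hb : e * hb = hb * e - 2 * eb := by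
  have := inc_lie (unbar e₀) (bar h₀)
  rw [lie_unbar_bar, ← lie_skew, lie_he, ← neg_smul, bar_smul, inc_smul, neg_two_smul'] at this
  rw [sub_eq_add_neg]
  exact sub_eq_iff_eq_add'.1 this

lemma comm_f_hb : f * hb = hb * f + 2 * fb := by
  have := inc_lie (unbar f₀) (bar h₀)
  rw [lie_unbar_bar, ← lie_skew, lie_hf, ← neg_smul, neg_neg, bar_smul, inc_smul,
    two_smul'] at this
  exact sub_eq_iff_eq_add'.1 this

lemma comm_bar (v w : Sl2) : inc (bar v) * inc (bar w) = inc (bar w) * inc (bar v) := by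
  have := inc_lie (bar v) (bar w)
  rw [lie_bar_bar, inc_zero] at this
  exact sub_eq_zero.1 this

lemma comm_eb_fb : eb * fb = fb * eb := comm_bar _ _
lemma comm_eb_hb : eb * hb = hb * eb := comm_bar _ _
lemma comm_hb_fb : hb * fb = fb * hb := comm_bar _ _

/-! ### The centre -/

/-- The element `C = h̄h + 2f̄e + 2ēf`. -/
def casimir : U := hb * h + 2 * (fb * e) + 2 * (eb * f)

/-- The element `C̄ = h̄² + 4f̄ē`. -/
def casimirBar : U := hb ^ 2 + 4 * (fb * eb)

lemma mem_center_of {z : U} (he : z * e = e * z) (hf : z * f = f * z) (hh : z * h = h * z)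
    (heb : z * eb = eb * z) (hfb : z * fb = fb * z) (hhb : z * hb = hb * z) :
    z ∈ Subalgebra.center ℂ U := by
  rw [Subalgebra.mem_center_iff]
  intro u
  refine U_induction' (P := fun u => u * z = z * u) (fun c => Algebra.commutes c z) he.symm hf.symm
    hh.symm heb.symm hfb.symm hhb.symm ?_ ?_ u
  · intro u v hu hv; rw [add_mul, mul_add, hu, hv]
  · intro u v hu hv; rw [mul_assoc, hv, ← mul_assoc, hu, mul_assoc]


lemma assoc_of {a b c : U} (hab : a * b = c) (x : U) : a * (b * x) = c * x := by
  rw [← mul_assoc, hab]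

lemma casimir_mem_center : casimir ∈ Subalgebra.center ℂ U := by
  apply mem_center_of <;>
    simp only [casimir, mul_add, add_mul, mul_sub, sub_mul, mul_assoc, two_mul, comm_ef, comm_he,
      comm_hf, comm_e_eb, comm_f_fb, comm_h_hb, comm_e_fb, comm_f_eb, comm_h_eb, comm_h_fb,
      comm_e_hb, comm_f_hb, comm_eb_fb, comm_eb_hb, comm_hb_fb, assoc_of comm_ef,
      assoc_of comm_he, assoc_of comm_hf, assoc_of comm_e_eb, assoc_of comm_f_fb,
      assoc_of comm_h_hb, assoc_of comm_e_fb, assoc_of comm_f_eb, assoc_of comm_h_eb,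
      assoc_of comm_h_fb, assoc_of comm_e_hb, assoc_of comm_f_hb, assoc_of comm_eb_fb,
      assoc_of comm_eb_hb, assoc_of comm_hb_fb] <;> abel

lemma casimirBar_mem_center : casimirBar ∈ Subalgebra.center ℂ U := by
  have h4 : ∀ u : U, 4 * u = u + u + u + u := fun u => by noncomm_ring
  apply mem_center_of <;>
    simp only [casimirBar, h4, pow_two, mul_add, add_mul, mul_sub, sub_mul, mul_assoc, two_mul,
      comm_e_eb, comm_f_fb, comm_h_hb, comm_e_fb, comm_f_eb, comm_h_eb, comm_h_fb,
      comm_e_hb, comm_f_hb, comm_eb_fb, comm_eb_hb, comm_hb_fb,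
      assoc_of comm_e_eb, assoc_of comm_f_fb,
      assoc_of comm_h_hb, assoc_of comm_e_fb, assoc_of comm_f_eb, assoc_of comm_h_eb,
      assoc_of comm_h_fb, assoc_of comm_e_hb, assoc_of comm_f_hb, assoc_of comm_eb_fb,
      assoc_of comm_eb_hb, assoc_of comm_hb_fb] <;> abel

/-- The centre `Z` of the enveloping algebra. -/
abbrev Z : Subalgebra ℂ U := Subalgebra.center ℂ U

/-- `C` and `C̄` as elements of the centre. -/
def C : Z := ⟨casimir, casimir_mem_center⟩
def Cbar : Z := ⟨casimirBar, casimirBar_mem_center⟩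

/-- The left ideal `U · Ker χ` (it is two-sided, as `Ker χ` is central). -/
def idealOfKer (χ : Z →ₐ[ℂ] ℂ) : Ideal U := Ideal.span (Subtype.val '' {z : Z | χ z = 0})

/-! ### Verma modules -/

/-- The left ideal generated by the elements `x - λ(x)`, for `x` in the standard basis
`e, ē, h, h̄` of the Borel subalgebra, where `λ(e) = λ(ē) = 0`, `λ(h) = l₁`, `λ(h̄) = l₂`. -/
def vermaIdeal (l₁ l₂ : ℂ) : Submodule U U :=
  Submodule.span U {e, eb, h - algebraMap ℂ U l₁, hb - algebraMap ℂ U l₂}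

/-- The Verma module `Δ(l₁, l₂)`: the module induced from the character `λ` of the Borel
subalgebra spanned by `e, ē, h, h̄`, that is, the `U`-module generated by one vector `v` subject
to `e v = ē v = 0`, `h v = l₁ v`, `h̄ v = l₂ v`. -/
abbrev Verma (l₁ l₂ : ℂ) : Type := U ⧸ vermaIdeal l₁ l₂

/-! ### Localisation at `f` -/

/-- The derivation `[f, -]` of `U`. -/
def adf (u : U) : U := f * u - u * f

lemma adf_mul (u v : U) : adf (u * v) = adf u * v + u * adf v := by
  unfold adf; noncomm_ring

lemma adf_add (u v : U) : adf (u + v) = adf u + adf v := by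
  unfold adf; noncomm_ring

lemma adf_zero : adf 0 = 0 := by simp [adf]

lemma adf_iter_zero (k : ℕ) : adf^[k] 0 = 0 := Function.iterate_fixed adf_zero k

lemma adf_iter_add (k : ℕ) (u v : U) : adf^[k] (u + v) = adf^[k] u + adf^[k] v := by
  induction k generalizing u v with
  | zero => rfl
  | succ k ih => simp only [Function.iterate_succ_apply, adf_add, ih]

lemma adf_iter_mul (n a b : ℕ) (hn : a + b ≤ n) (u v : U) (hu : adf^[a] u = 0)
    (hv : adf^[b] v = 0) : adf^[n] (u * v) = 0 := by
  induction n generalizing a b u v with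
  | zero =>
    obtain rfl : a = 0 := by omega
    simp only [Function.iterate_zero, id] at hu
    simp [hu]
  | succ n ih =>
    rcases Nat.eq_zero_or_pos a with rfl | ha
    · simp only [Function.iterate_zero, id] at hu
      rw [hu, zero_mul, adf_iter_zero]
    rcases Nat.eq_zero_or_pos b with rfl | hb
    · simp only [Function.iterate_zero, id] at hv
      rw [hv, mul_zero, adf_iter_zero]
    obtain ⟨a, rfl⟩ : ∃ a', a = a' + 1 := ⟨a - 1, by omega⟩
    obtain ⟨b, rfl⟩ : ∃ b', b = b' + 1 := ⟨b - 1, by omega⟩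
    rw [Function.iterate_succ_apply, adf_mul, adf_iter_add,
      ih a (b + 1) (by omega) _ _ (by rwa [Function.iterate_succ_apply] at hu) hv,
      ih (a + 1) b (by omega) _ _ hu (by rwa [Function.iterate_succ_apply] at hv), add_zero]

/-- The derivation `[f, -]` is locally nilpotent on `U`. -/
lemma adf_nilpotent (u : U) : ∃ k, adf^[k] u = 0 := by
  have mono : ∀ {k l : ℕ} {u : U}, k ≤ l → adf^[k] u = 0 → adf^[l] u = 0 := by
    intro k l u hkl hu
    obtain ⟨m, rfl⟩ := Nat.exists_eq_add_of_le' hkl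
    rw [Function.iterate_add_apply, hu, adf_iter_zero]
  have dh : adf h = 2 * f := by rw [adf, comm_hf]; abel
  have dhb : adf hb = 2 * fb := by rw [adf, comm_f_hb]; abel
  have df : adf f = 0 := by simp [adf]
  have dfb : adf fb = 0 := by rw [adf, comm_f_fb, sub_self]
  have d2f : adf (2 * f) = 0 := by rw [two_mul, adf_add, df, add_zero]
  have d2fb : adf (2 * fb) = 0 := by rw [two_mul, adf_add, dfb, add_zero]
  have hneg : ∀ u, adf (-u) = -adf u := fun u => by unfold adf; noncomm_ring
  have de : adf e = -h := by rw [adf, comm_ef]; abel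
  have deb : adf eb = -hb := by rw [adf, comm_f_eb]; abel
  refine U_induction' (P := fun u => ∃ k, adf^[k] u = 0) (fun c => ⟨1, ?_⟩)
    ⟨3, ?_⟩ ⟨1, ?_⟩ ⟨2, ?_⟩ ⟨3, ?_⟩ ⟨1, ?_⟩ ⟨2, ?_⟩ ?_ ?_ u
  · simp [adf, Algebra.commutes]
  · simp [de, dh, d2f, hneg]
  · simp [df]
  · simp [dh, d2f]
  · simp [deb, dhb, d2fb, hneg]
  · simp [dfb]
  · simp [dhb, d2fb]
  · rintro u v ⟨k, hk⟩ ⟨l, hl⟩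
    refine ⟨max k l, ?_⟩
    rw [adf_iter_add, mono (le_max_left k l) hk, mono (le_max_right k l) hl, add_zero]
  · rintro u v ⟨k, hk⟩ ⟨l, hl⟩
    exact ⟨k + l, adf_iter_mul _ _ _ le_rfl _ _ hk hl⟩

/-- If a left ideal `I` is stable under right multiplication by `f` and `u f ^ n ∈ I`, then
`f ^ m u ∈ I` for some `m`. -/
lemma exists_pow_mul_mem (I : Submodule U U) (hI : ∀ u ∈ I, u * f ∈ I) (n k : ℕ) (u : U)
    (hk : adf^[k] u = 0) (hu : u * f ^ n ∈ I) : ∃ m : ℕ, f ^ m * u ∈ I := by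
  induction k generalizing u with
  | zero => exact ⟨0, by simp_all⟩
  | succ k ih =>
    have hd : adf u * f ^ n ∈ I := by
      have : adf u * f ^ n = f * (u * f ^ n) - (u * f ^ n) * f := by
        rw [adf, sub_mul, mul_assoc, mul_assoc u f, mul_assoc u, ← pow_succ', ← pow_succ]
      rw [this]
      exact I.sub_mem (I.smul_mem f hu) (hI _ hu)
    obtain ⟨m, hm⟩ := ih (adf u) (by rwa [Function.iterate_succ_apply] at hk) hd
    have key : ∀ j : ℕ, f ^ (m + j) * u - f ^ m * u * f ^ j ∈ I := by
      intro j
      induction j with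
      | zero => simp
      | succ j ihj =>
        have : f ^ (m + (j + 1)) * u - f ^ m * u * f ^ (j + 1) =
            f ^ j * (f ^ m * adf u) + (f ^ (m + j) * u - f ^ m * u * f ^ j) * f := by
          have h1 : f ^ j * (f ^ m * adf u) = f ^ (m + (j + 1)) * u - f ^ (m + j) * u * f := by
            rw [← mul_assoc, ← pow_add, add_comm j m, adf, mul_sub, ← mul_assoc, ← pow_succ,
              ← mul_assoc, add_assoc]
          rw [h1, sub_mul, mul_assoc (f ^ m * u), ← pow_succ]
          abel
        rw [this]
        exact I.add_mem (I.smul_mem _ hm) (hI _ ihj)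
    refine ⟨m + n, ?_⟩
    have h2 : f ^ m * u * f ^ n ∈ I := by
      rw [mul_assoc]; exact I.smul_mem _ hu
    simpa using I.add_mem (key n) h2

/-- The multiplicative set `{1, f, f², …}` satisfies the Ore conditions. -/
lemma nonempty_oreSet : Nonempty (OreLocalization.OreSet (Submonoid.powers f)) := by
  rw [OreLocalization.nonempty_oreSet_iff]
  constructor
  · rintro r₁ r₂ ⟨_, n, rfl⟩ hr
    obtain ⟨k, hk⟩ := adf_nilpotent (r₁ - r₂)
    obtain ⟨m, hm⟩ := exists_pow_mul_mem ⊥ (by simp) n k (r₁ - r₂) hk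
      (by simp only [Submodule.mem_bot, sub_mul]; exact sub_eq_zero.2 hr)
    refine ⟨⟨f ^ m, m, rfl⟩, ?_⟩
    simp only [Submodule.mem_bot, mul_sub] at hm
    exact sub_eq_zero.1 hm
  · rintro r ⟨_, n, rfl⟩
    obtain ⟨k, hk⟩ := adf_nilpotent r
    obtain ⟨m, hm⟩ := exists_pow_mul_mem (Submodule.span U {f ^ n})
      (by
        intro u hu
        obtain ⟨a, rfl⟩ := Submodule.mem_span_singleton.1 hu
        refine Submodule.mem_span_singleton.2 ⟨a * f, ?_⟩
        simp only [smul_eq_mul, mul_assoc, ← pow_succ, ← pow_succ'])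
      n k r hk (Submodule.mem_span_singleton.2 ⟨r, rfl⟩)
    obtain ⟨a, ha⟩ := Submodule.mem_span_singleton.1 hm
    exact ⟨a, ⟨f ^ m, m, rfl⟩, ha.symm⟩

instance oreSet : OreLocalization.OreSet (Submonoid.powers f) := nonempty_oreSet.some

instance finite_dualNumber : Module.Finite ℂ (DualNumber ℂ) :=
  inferInstanceAs (Module.Finite ℂ (ℂ × ℂ))

instance finite_T : Module.Finite ℂ T :=
  inferInstanceAs (Module.Finite ℂ (DualNumber ℂ ⊗[ℂ] Sl2))

section Completion

variable (M : Type) [AddCommGroup M] [Module ℂ M] [Module U M] [IsScalarTower ℂ U M]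

/-- The localisation `U_(f) ⊗_U M` of a module, consisting of fractions `f⁻ᵏ m`. -/
abbrev Loc : Type := OreLocalization (Submonoid.powers f) M

/-- The canonical map `j : M → U_(f) ⊗_U M`, `m ↦ 1 ⊗ m`. -/
def toLoc : M →ₗ[U] Loc M where
  toFun m := OreLocalization.oreDiv m 1
  map_add' _ _ := OreLocalization.add_oreDiv.symm
  map_smul' r m := (OreLocalization.smul_oreDiv_one r m).symm

/-- The twisted module `S_f ⊗_U M`, where `S_f = U_(f) / U`, as the quotient of `U_(f) ⊗_U M` by
the image of `M` (these agree by right exactness of the tensor product). -/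
abbrev Twist : Type := Loc M ⧸ LinearMap.range (toLoc M)

variable {M}

/-- The action of `e` on `m` is locally finite: `dim ℂ[e] m < ∞`. -/
def IsLocallyFinite (m : M) : Prop :=
  FiniteDimensional ℂ (Submodule.span ℂ (Set.range fun k : ℕ => e ^ k • m))

/-- The operator by which an element of `U` acts on `M`. -/
def act (u : U) : M →ₗ[ℂ] M where
  toFun m := u • m
  map_add' := smul_add u
  map_smul' c m := by
    rw [RingHom.id_apply, ← algebraMap_smul U c m, ← mul_smul, ← Algebra.commutes, mul_smul,
      algebraMap_smul]

lemma isLocallyFinite_iff (m : M) : IsLocallyFinite m ↔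
    ∃ W : Submodule ℂ M, FiniteDimensional ℂ W ∧ m ∈ W ∧ ∀ w ∈ W, e • w ∈ W := by
  constructor
  · intro hm
    refine ⟨_, hm, Submodule.subset_span ⟨0, by simp⟩, ?_⟩
    intro w hw
    have : Submodule.span ℂ (Set.range fun k : ℕ => e ^ k • m) ≤
        (Submodule.span ℂ (Set.range fun k : ℕ => e ^ k • m)).comap (act e) := by
      rw [Submodule.span_le]
      rintro _ ⟨k, rfl⟩
      refine Submodule.subset_span ⟨k + 1, ?_⟩
      simp [act, pow_succ', mul_smul]
    exact this hw
  · rintro ⟨W, hW, hm, hst⟩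
    have : Submodule.span ℂ (Set.range fun k : ℕ => e ^ k • m) ≤ W := by
      rw [Submodule.span_le]
      rintro _ ⟨k, rfl⟩
      change e ^ k • m ∈ W
      induction k with
      | zero => simpa using hm
      | succ k ih => rw [pow_succ', mul_smul]; exact hst _ ih
    exact Submodule.finiteDimensional_of_le this

lemma IsLocallyFinite.add {m m' : M} (hm : IsLocallyFinite m) (hm' : IsLocallyFinite m') :
    IsLocallyFinite (m + m') := by
  rw [isLocallyFinite_iff] at *
  obtain ⟨W, _, h1, h2⟩ := hm
  obtain ⟨W', _, h1', h2'⟩ := hm'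
  refine ⟨W ⊔ W', inferInstance, Submodule.add_mem_sup h1 h1', ?_⟩
  intro w hw
  obtain ⟨a, ha, b, hb, rfl⟩ := Submodule.mem_sup.1 hw
  rw [smul_add]
  exact Submodule.add_mem_sup (h2 a ha) (h2' b hb)

lemma IsLocallyFinite.smul {m : M} (hm : IsLocallyFinite m) (u : U) : IsLocallyFinite (u • m) := by
  induction u using U_induction generalizing m with
  | halg c =>
    rw [isLocallyFinite_iff] at *
    obtain ⟨W, hW, h1, h2⟩ := hm
    exact ⟨W, hW, by rw [algebraMap_smul]; exact W.smul_mem c h1, h2⟩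
  | hinc x =>
    rw [isLocallyFinite_iff] at *
    obtain ⟨W, hW, h1, h2⟩ := hm
    let b : T →ₗ[ℂ] M →ₗ[ℂ] M :=
      { toFun := fun x => act (inc x)
        map_add' := fun x y => by ext m; simp [act, inc_add, add_smul]
        map_smul' := fun c x => by ext m; simp [act, inc_smul] }
    refine ⟨Submodule.map₂ b ⊤ W, ?_, Submodule.apply_mem_map₂ b (Submodule.mem_top (x := x)) h1, ?_⟩
    · rw [FiniteDimensional, Module.Finite.iff_fg]
      exact Submodule.FG.map₂ b Module.Finite.fg_top (Module.Finite.iff_fg.1 hW)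
    · have : Submodule.map₂ b ⊤ W ≤ (Submodule.map₂ b ⊤ W).comap (act e) := by
        rw [Submodule.map₂_le]
        intro y _ w hw
        have h3 : act e (b y w) = b y (e • w) + b ⁅unbar e₀, y⁆ w := by
          change e • inc y • w = inc y • e • w + inc _ • w
          rw [← inc_lie, ← mul_smul, ← mul_smul, ← add_smul]
          congr 1
          change _ = _ + (e * _ - _ * e)
          abel
        rw [Submodule.mem_comap, h3]
        exact Submodule.add_mem _ (Submodule.apply_mem_map₂ b Submodule.mem_top (h2 w hw))
          (Submodule.apply_mem_map₂ b Submodule.mem_top hw)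
      intro w hw
      exact this hw
  | hadd u v hu hv => rw [add_smul]; exact (hu hm).add (hv hm)
  | hmul u v hu hv => rw [mul_smul]; exact hu (hv hm)

variable (M)

/-- The `U`-submodule of all elements of `M` on which `e` acts locally finitely. -/
def locallyFinitePart : Submodule U M where
  carrier := {m | IsLocallyFinite m}
  add_mem' := IsLocallyFinite.add
  zero_mem' := (isLocallyFinite_iff 0).2 ⟨⊥, inferInstance, by simp, by simp⟩
  smul_mem' u _ hm := IsLocallyFinite.smul hm u

/-- The Enright-Arkhipov completion of `M`: the `e`-locally finite part of `S_f ⊗_U M`. -/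
abbrev EnAr : Type := locallyFinitePart (Twist M)

end Completion

/-- The module `V(n, l)`, the completion of the Verma module `Δ(n - 2, l)`. -/
abbrev V (n : ℤ) (l : ℂ) : Type := EnAr (Verma ((n : ℂ) - 2) l)

end TakiffSl2

end

/-!
Both `Δ(n - 2, λ)` and `V(n, λ)` are nonzero `U`-modules on which `C` and `C̄` act by `nλ` and
`λ² ≠ 0`. So the theorem follows once the ideal generated by `C - a` and `C̄ - b` is maximal as a
two-sided ideal for `b ≠ 0`, and the centre is generated, up to `C̄`-torsion, by `C` and `C̄`.

Up to multiplication by powers of `ē`, the algebra `U` is an iterated Ore extension of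
`ℂ[C, C̄]` by `ē`, `e`, `h̄`, `h`. Iterated commutators with the generators lower the degree, and
thus take a nonzero element of a two-sided ideal down to a nonzero element of `ℂ[C, C̄][ē]`;
weights of `ad h` isolate one of its coefficients, and `ē` is invertible modulo a two-sided ideal
up to powers of `C̄`.

To see that `V(n, λ) ≠ 0`, compare dimensions of weight spaces of the Verma module: the one of
depth `k + 1` has dimension `k + 2`, so `e` kills a nonzero vector `s` there. Then `e` also kills
`f⁻ᴺ s` for the right `N`, and this fraction is not in the Verma module as `s` has degree less
than `N` in `f̄` and `f`.
-/

open LieAlgebra (ad)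

noncomputable section

namespace TakiffSl2

attribute [local instance 100] LieRing.ofAssociativeRing

/-! ### Iterated commutators in Ore extensions -/

section Ore

variable {K A : Type*} [Field K] [Ring A] [Algebra K A]

lemma lie_mul (t u v : A) : ⁅t, u * v⁆ = ⁅t, u⁆ * v + u * ⁅t, v⁆ := by
  simp only [Ring.lie_def]
  noncomm_ring

lemma lie_pow_succ {t x : A} (hx : Commute x ⁅t, x⁆) (n : ℕ) :
    ⁅t, x ^ (n + 1)⁆ = (n + 1) • (⁅t, x⁆ * x ^ n) := by
  induction n with
  | zero => simp
  | succ n ih => rw [pow_succ', lie_mul, ih, mul_smul_comm, ← mul_assoc, hx.eq, mul_assoc,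
      ← pow_succ', succ_nsmul' _ (n + 1)]

lemma lie_mem_adjoin {s : Set A} {x : A} (h : ∀ y ∈ s, ⁅x, y⁆ ∈ Algebra.adjoin K s) {u : A}
    (hu : u ∈ Algebra.adjoin K s) : ⁅x, u⁆ ∈ Algebra.adjoin K s := by
  induction hu using Algebra.adjoin_induction with
  | mem y hy => exact h y hy
  | algebraMap r => rw [(Algebra.commute_algebraMap_right r x).lie_eq]; exact zero_mem _
  | add u v _ _ hu hv => rw [lie_add]; exact add_mem hu hv
  | mul u v hu' hv' hu hv => rw [lie_mul]; exact add_mem (mul_mem hu hv') (mul_mem hu' hv)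

lemma ad_pow_eq_zero_or_eq_self {t x : A} (h : Commute t x) (i : ℕ) :
    (ad K A t ^ i) x = 0 ∨ (ad K A t ^ i) x = x := by
  cases i with
  | zero => exact .inr rfl
  | succ i =>
    rw [pow_succ, Module.End.mul_apply, LieAlgebra.ad_apply, h.lie_eq, map_zero]
    exact .inl rfl

lemma map_ad_pow_eq_zero {A' : Type*} [Ring A'] [Algebra K A'] {ψ : A →ₐ[K] A'} {x : A}
    (hx : ψ x = 0) (t : A) (i : ℕ) : ψ ((ad K A t ^ i) x) = 0 := by
  induction i with
  | zero => exact hx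
  | succ i ih =>
    rw [pow_succ', Module.End.mul_apply, LieAlgebra.ad_apply, Ring.lie_def, map_sub, map_mul,
      map_mul, ih, mul_zero, zero_mul, sub_zero]

lemma ad_pow_mul_of_commute {t s : A} (hs : Commute t s) (k : ℕ) (y : A) :
    (ad K A t ^ k) (s * y) = s * (ad K A t ^ k) y := by
  have : Commute (ad K A t) (LinearMap.mulLeft K s) := by
    ext y
    simp [lie_mul, hs.lie_eq]
  exact LinearMap.congr_fun (this.pow_left k).eq y

lemma ad_pow_succ_mul {t x : A} (hx : Commute t ⁅t, x⁆) (k : ℕ) (y : A) :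
    (ad K A t ^ (k + 1)) (x * y) =
      x * (ad K A t ^ (k + 1)) y + (k + 1) • (⁅t, x⁆ * (ad K A t ^ k) y) := by
  induction k with
  | zero => simp [lie_mul, add_comm]
  | succ k ih =>
    simp only [pow_succ' (ad K A t) (k + 1), Module.End.mul_apply, ih, map_add, map_nsmul,
      LieAlgebra.ad_apply, lie_mul, hx.lie_eq, zero_mul, zero_add]
    simp only [pow_succ' (ad K A t), Module.End.mul_apply, LieAlgebra.ad_apply]
    module

lemma ad_pow_self_pow {t x : A} (hx : Commute t ⁅t, x⁆) (m : ℕ) :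
    (ad K A t ^ m) (x ^ m) = m.factorial • ⁅t, x⁆ ^ m ∧ (ad K A t ^ (m + 1)) (x ^ m) = 0 := by
  induction m with
  | zero => simp [(Commute.one_right t).lie_eq]
  | succ m ih =>
    have hkill : (ad K A t ^ (m + 2)) (x ^ m) = 0 := by
      rw [pow_succ', Module.End.mul_apply, ih.2, map_zero]
    constructor
    · rw [pow_succ' x, ad_pow_succ_mul hx, ih.1, ih.2, mul_zero, zero_add, mul_smul_comm,
        ← pow_succ', smul_smul, Nat.factorial_succ]
    · rw [pow_succ' x, ad_pow_succ_mul hx, ih.2, hkill, mul_zero, mul_zero, smul_zero, add_zero]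

lemma ad_pow_pow_of_lt {t x : A} (hx : Commute t ⁅t, x⁆) {i m : ℕ} (h : i < m) :
    (ad K A t ^ m) (x ^ i) = 0 := by
  rw [← Nat.sub_add_cancel h, pow_add, Module.End.mul_apply, (ad_pow_self_pow hx i).2, map_zero]

lemma ad_pow_natDegree_eval {t x : A} (hx : Commute t ⁅t, x⁆) (p : Polynomial A)
    (hp : ∀ i, Commute t (p.coeff i)) :
    (ad K A t ^ p.natDegree) (p.eval x) =
      p.natDegree.factorial • (p.leadingCoeff * ⁅t, x⁆ ^ p.natDegree) := by
  rw [Polynomial.eval_eq_sum_range, map_sum, Finset.sum_range_succ, Finset.sum_eq_zero, zero_add,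
    ad_pow_mul_of_commute (hp _), (ad_pow_self_pow hx _).1, mul_smul_comm, Polynomial.leadingCoeff]
  intro i hi
  rw [ad_pow_mul_of_commute (hp _), ad_pow_pow_of_lt hx (Finset.mem_range.1 hi), mul_zero]

lemma adjoin_insert_le_mul {s : Set A} {x : A} (h : ∀ y ∈ s, ⁅x, y⁆ ∈ Algebra.adjoin K s) :
    (Algebra.adjoin K (insert x s)).toSubmodule ≤
      (Algebra.adjoin K s).toSubmodule * (Algebra.adjoin K {x}).toSubmodule := by
  set N := (Algebra.adjoin K s).toSubmodule * (Algebra.adjoin K {x}).toSubmodule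
  have hx : x ∈ Algebra.adjoin K {x} := Algebra.self_mem_adjoin_singleton K x
  have hmul_x : ∀ y ∈ N, x * y ∈ N := fun y hy => by
    induction hy using Submodule.mul_induction_on' with
    | mem_mul_mem a ha p hp =>
      rw [show x * (a * p) = ⁅x, a⁆ * p + a * (x * p) by rw [Ring.lie_def]; noncomm_ring]
      exact N.add_mem (Submodule.mul_mem_mul (lie_mem_adjoin h ha) hp)
        (Submodule.mul_mem_mul ha (Subalgebra.mul_mem _ hx hp))
    | add u _ v _ hu hv => rw [mul_add]; exact N.add_mem hu hv
  have hmul_s : ∀ a ∈ s, ∀ y ∈ N, a * y ∈ N := fun a ha y hy => by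
    induction hy using Submodule.mul_induction_on' with
    | mem_mul_mem b hb p hp =>
      rw [← mul_assoc]
      exact Submodule.mul_mem_mul (Subalgebra.mul_mem _ (Algebra.subset_adjoin ha) hb) hp
    | add u _ v _ hu hv => rw [mul_add]; exact N.add_mem hu hv
  have hmul : ∀ a ∈ Algebra.adjoin K (insert x s), ∀ y ∈ N, a * y ∈ N := fun a ha => by
    induction ha using Algebra.adjoin_induction with
    | mem a ha => exact ha.elim (fun h => h ▸ hmul_x) (hmul_s a)
    | algebraMap r => intro y hy; rw [← Algebra.smul_def]; exact N.smul_mem r hy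
    | add u v _ _ hu hv => intro y hy; rw [add_mul]; exact N.add_mem (hu y hy) (hv y hy)
    | mul u v _ _ hu hv => intro y hy; rw [mul_assoc]; exact hu _ (hv y hy)
  intro u hu
  have h1 : (1 : A) ∈ N := mul_one (1 : A) ▸ Submodule.mul_mem_mul
    (one_mem (Algebra.adjoin K s)) (one_mem (Algebra.adjoin K {x}))
  simpa using hmul u hu 1 h1

lemma exists_eval_eq_of_mem_adjoin_insert {s : Set A} {x u : A}
    (h : ∀ y ∈ s, ⁅x, y⁆ ∈ Algebra.adjoin K s) (hu : u ∈ Algebra.adjoin K (insert x s)) :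
    ∃ p : Polynomial A, (∀ i, p.coeff i ∈ Algebra.adjoin K s) ∧ p.eval x = u := by
  replace hu := adjoin_insert_le_mul h hu
  induction hu using Submodule.mul_induction_on' with
  | mem_mul_mem a ha y hy =>
    obtain ⟨q, rfl⟩ := (Algebra.adjoin_singleton_eq_range_aeval K x).le hy
    refine ⟨Polynomial.C a * q.map (algebraMap K A), fun i => ?_, ?_⟩
    · rw [Polynomial.coeff_C_mul, Polynomial.coeff_map]
      exact mul_mem ha (Subalgebra.algebraMap_mem _ _)
    · simp [Polynomial.eval_C_mul, Polynomial.aeval_def, Polynomial.eval_map]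
  | add u _ v _ hu hv =>
    obtain ⟨p, hp, rfl⟩ := hu
    obtain ⟨q, hq, rfl⟩ := hv
    exact ⟨p + q, fun i => by rw [Polynomial.coeff_add]; exact add_mem (hp i) (hq i), by simp⟩

/- Applying `[t, -]` as often as the degree of a polynomial in `x` leaves a multiple of its leading
coefficient. -/
lemma exists_ad_pow_mem_adjoin [CharZero K] {s : Set A} {t x u : A}
    (hx : ∀ y ∈ s, ⁅x, y⁆ ∈ Algebra.adjoin K s) (ht : ∀ y ∈ s, Commute t y)
    (hτ : ⁅t, x⁆ ∈ Algebra.adjoin K s) (hτs : ∀ y ∈ s, Commute ⁅t, x⁆ y)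
    (hreg : IsLeftRegular ⁅t, x⁆) (hu : u ∈ Algebra.adjoin K (insert x s)) (hu0 : u ≠ 0) :
    ∃ m : ℕ, (ad K A t ^ m) u ∈ Algebra.adjoin K s ∧ (ad K A t ^ m) u ≠ 0 := by
  obtain ⟨p, hp, rfl⟩ := exists_eval_eq_of_mem_adjoin_insert hx hu
  have hcomm : ∀ y ∈ Algebra.adjoin K s, Commute t y := fun y hy =>
    Algebra.commute_of_mem_adjoin_of_forall_mem_commute hy ht
  have hlead : Commute (⁅t, x⁆ ^ p.natDegree) p.leadingCoeff :=
    (Algebra.commute_of_mem_adjoin_of_forall_mem_commute (hp _) hτs).pow_left _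
  refine ⟨p.natDegree, ?_⟩
  rw [ad_pow_natDegree_eval (hcomm _ hτ) p fun i => hcomm _ (hp i), ← Nat.cast_smul_eq_nsmul K]
  refine ⟨Subalgebra.smul_mem _ (mul_mem (hp _) (pow_mem hτ _)) _, ?_⟩
  rw [Ne, smul_eq_zero_iff_right (Nat.cast_ne_zero.2 (Nat.factorial_ne_zero _)), ← hlead.eq,
    (hreg.pow _).mul_left_eq_zero_iff, Polynomial.leadingCoeff_eq_zero]
  rintro rfl
  simp at hu0

lemma lie_pow_of_lie_eq_smul {t x : A} {c : K} (htx : ⁅t, x⁆ = c • x) (n : ℕ) :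
    ⁅t, x ^ n⁆ = ((n : K) * c) • x ^ n := by
  cases n with
  | zero => simp [(Commute.one_right t).lie_eq]
  | succ n =>
    rw [lie_pow_succ (htx ▸ (Commute.refl x).smul_right c), htx, smul_mul_assoc, ← pow_succ',
      ← Nat.cast_smul_eq_nsmul K, smul_smul]

/- The terms of a polynomial in an eigenvector `x` of `[t, -]` lie in different eigenspaces. -/
lemma coeff_mul_pow_eq_zero [CharZero K] {t x : A} {c : K} (hc : c ≠ 0) (htx : ⁅t, x⁆ = c • x)
    {p : Polynomial A} (hp : ∀ i, Commute t (p.coeff i)) (hpx : p.eval x = 0) (i : ℕ) :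
    p.coeff i * x ^ i = 0 := by
  have hmem : ∀ i : ℕ,
      p.coeff i * x ^ i ∈ Module.End.eigenspace (ad K A t) ((i : K) * c) := fun i => by
    rw [Module.End.mem_eigenspace_iff, LieAlgebra.ad_apply, lie_mul, (hp i).lie_eq, zero_mul,
      zero_add, lie_pow_of_lie_eq_smul htx, mul_smul_comm]
  have hindep := (Module.End.eigenspaces_iSupIndep (ad K A t)).comp
    ((mul_left_injective₀ hc).comp Nat.cast_injective)
  by_cases hi : i ∈ Finset.range (p.natDegree + 1)
  · exact (iSupIndep_iff_finsetSum_eq_zero_imp_eq_zero _).1 hindep _ _ (fun i _ => hmem i)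
      (by rw [← Polynomial.eval_eq_sum_range, hpx]) i hi
  · rw [Polynomial.coeff_eq_zero_of_natDegree_lt (by simpa using hi), zero_mul]

/-- The subalgebra of all `u` which can be moved into the subalgebra `B` by powers of `s ∈ B`: for
every `N` there is an equation `s ^ M * u = b * s ^ N` with `b ∈ B`. -/
def leftFractions (B : Subalgebra K A) {s : A} (hs : s ∈ B) : Subalgebra K A where
  carrier := {u | ∀ N : ℕ, ∃ M : ℕ, ∃ b ∈ B, s ^ M * u = b * s ^ N}
  algebraMap_mem' c N := ⟨N, algebraMap K A c, B.algebraMap_mem c, (Algebra.commutes c _).symm⟩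
  mul_mem' {u v} hu hv N := by
    obtain ⟨M, b, hb, hM⟩ := hv N
    obtain ⟨M', b', hb', hM'⟩ := hu M
    exact ⟨M', b' * b, B.mul_mem hb' hb, by rw [← mul_assoc, hM', mul_assoc, hM, mul_assoc]⟩
  add_mem' {u v} hu hv N := by
    obtain ⟨M, b, hb, hM⟩ := hu N
    obtain ⟨M', b', hb', hM'⟩ := hv N
    refine ⟨M + M', s ^ M' * b + s ^ M * b',
      B.add_mem (B.mul_mem (B.pow_mem hs _) hb) (B.mul_mem (B.pow_mem hs _) hb'), ?_⟩
    rw [mul_add, add_mul, mul_assoc, mul_assoc, ← hM, ← hM', ← mul_assoc, ← mul_assoc, ← pow_add,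
      ← pow_add, add_comm M' M]

lemma mem_leftFractions_of_commute {B : Subalgebra K A} {s : A} (hs : s ∈ B) {u : A} (hu : u ∈ B)
    (hsu : Commute s u) : u ∈ leftFractions B hs :=
  fun N => ⟨N, u, hu, (hsu.pow_left N).eq⟩

end Ore

/-! ### Quotients of `U` on which `C̄` is regular -/

section Regular

variable {A : Type*} [Ring A] [Algebra ℂ A] (φ : U →ₐ[ℂ] A)

lemma map_lie (a b : U) : ⁅φ a, φ b⁆ = φ ⁅a, b⁆ := by
  simp only [Ring.lie_def, map_sub, map_mul]

lemma lie_e_hb : ⁅e, hb⁆ = (-2 : ℂ) • eb := by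
  rw [Ring.lie_def, comm_e_hb, neg_two_smul']; abel

lemma lie_hb_e : ⁅hb, e⁆ = (2 : ℂ) • eb := by
  rw [Ring.lie_def, comm_e_hb, two_smul']; abel

lemma lie_eb_h : ⁅eb, h⁆ = (-2 : ℂ) • eb := by
  rw [Ring.lie_def, comm_h_eb, neg_two_smul']; abel

lemma lie_h_eb : ⁅h, eb⁆ = (2 : ℂ) • eb := by
  rw [Ring.lie_def, comm_h_eb, two_smul']; abel

lemma lie_h_e : ⁅h, e⁆ = (2 : ℂ) • e := by
  rw [Ring.lie_def, comm_he, two_smul']; abel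

lemma lie_f_eb : ⁅f, eb⁆ = -hb := by
  rw [Ring.lie_def, comm_f_eb]; abel

lemma lie_f_eb_pow_succ (n : ℕ) : ⁅f, eb ^ (n + 1)⁆ = -((n + 1) • (hb * eb ^ n)) := by
  have : Commute eb ⁅f, eb⁆ := lie_f_eb ▸ Commute.neg_right comm_eb_hb
  rw [lie_pow_succ this, lie_f_eb, neg_mul, smul_neg]

lemma eb_pow_mul_h (n : ℕ) : eb ^ n * h = (h - algebraMap ℂ U (n * 2)) * eb ^ n := by
  rw [sub_mul, ← Algebra.smul_def, ← lie_pow_of_lie_eq_smul lie_h_eb, Ring.lie_def, sub_sub_cancel]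

lemma eb_pow_succ_mul_f (n : ℕ) : eb ^ (n + 1) * f = (f * eb + (n + 1) • hb) * eb ^ n := by
  rw [add_mul, smul_mul_assoc, mul_assoc, ← pow_succ', ← sub_neg_eq_add, ← lie_f_eb_pow_succ,
    Ring.lie_def, sub_sub_cancel]

/-- The subalgebra generated by the images of `C` and `C̄`. -/
def casimirAlg : Subalgebra ℂ A := Algebra.adjoin ℂ {φ casimir, φ casimirBar}

/-- The iterated Ore extension of `ℂ[C, C̄]` by the elements of the Borel subalgebra. -/
def borelAlg : Subalgebra ℂ A :=
  Algebra.adjoin ℂ {φ h, φ hb, φ e, φ eb, φ casimir, φ casimirBar}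

variable {φ}

lemma commute_map_casimir (u : U) : Commute (φ u) (φ casimir) :=
  Commute.map (Subalgebra.mem_center_iff.1 casimir_mem_center u) φ

lemma commute_map_casimirBar (u : U) : Commute (φ u) (φ casimirBar) :=
  Commute.map (Subalgebra.mem_center_iff.1 casimirBar_mem_center u) φ

lemma eb_mem_borelAlg : φ eb ∈ borelAlg φ := Algebra.subset_adjoin (by simp)

lemma fb_mul_eb_mem_borelAlg : φ (fb * eb) ∈ borelAlg φ := by
  have h4 : (4 : ℂ) • (fb * eb) = casimirBar - hb ^ 2 := by
    rw [casimirBar, add_sub_cancel_left, Algebra.smul_def, map_ofNat]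
  have : fb * eb = (4 : ℂ)⁻¹ • (casimirBar - hb ^ 2) := by
    rw [← h4, inv_smul_smul₀ (by norm_num)]
  rw [this, map_smul, map_sub, map_pow]
  exact Subalgebra.smul_mem _ (sub_mem (Algebra.subset_adjoin (by simp))
    (pow_mem (Algebra.subset_adjoin (by simp)) 2)) _

lemma f_mul_eb_sq_mem_borelAlg : φ (f * eb ^ 2) ∈ borelAlg φ := by
  have h2 : (2 : ℂ) • (f * eb ^ 2) =
      casimir * eb - hb * h * eb - (2 : ℂ) • (fb * eb * e) - (2 : ℂ) • (hb * eb) := by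
    have hf : f * eb ^ 2 = eb * f * eb - hb * eb := by
      rw [pow_two, ← mul_assoc, comm_f_eb, sub_mul]
    have he : fb * eb * e = fb * e * eb := by rw [mul_assoc, ← comm_e_eb, mul_assoc]
    rw [hf, he, casimir]
    simp only [two_smul]
    noncomm_ring
  have hC : φ casimir ∈ borelAlg φ := Algebra.subset_adjoin (by simp)
  have hh : φ h ∈ borelAlg φ := Algebra.subset_adjoin (by simp)
  have hhb : φ hb ∈ borelAlg φ := Algebra.subset_adjoin (by simp)
  have he : φ e ∈ borelAlg φ := Algebra.subset_adjoin (by simp)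
  have heb := eb_mem_borelAlg (φ := φ)
  rw [← inv_smul_smul₀ (two_ne_zero' ℂ) (f * eb ^ 2), h2]
  simp only [map_smul, map_sub, map_mul φ casimir, map_mul φ _ e, map_mul φ _ eb, map_mul φ hb h]
  refine Subalgebra.smul_mem _ (sub_mem (sub_mem (sub_mem (mul_mem hC heb)
    (mul_mem (mul_mem hhb hh) heb)) (Subalgebra.smul_mem _ ?_ _))
    (Subalgebra.smul_mem _ (mul_mem hhb heb) _)) _
  rw [← map_mul]
  exact mul_mem fb_mul_eb_mem_borelAlg he

lemma map_mem_leftFractions (u : U) : φ u ∈ leftFractions (borelAlg φ) eb_mem_borelAlg := by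
  have hcomm : ∀ {x : U}, φ x ∈ borelAlg φ → Commute eb x →
      φ x ∈ leftFractions (borelAlg φ) eb_mem_borelAlg := fun hx hc =>
    mem_leftFractions_of_commute _ hx (hc.map φ)
  induction u using U_induction' with
  | halg c => rw [AlgHom.commutes]; exact Subalgebra.algebraMap_mem _ c
  | he => exact hcomm (Algebra.subset_adjoin (by simp)) comm_e_eb.symm
  | heb => exact hcomm eb_mem_borelAlg rfl
  | hhb => exact hcomm (Algebra.subset_adjoin (by simp)) comm_eb_hb
  | hh =>
    refine fun N => ⟨N, φ (h - algebraMap ℂ U (N * 2)), ?_, ?_⟩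
    · rw [map_sub, AlgHom.commutes]
      exact sub_mem (Algebra.subset_adjoin (by simp)) (Subalgebra.algebraMap_mem _ _)
    · rw [← map_pow, ← map_mul, ← map_mul, eb_pow_mul_h]
  | hfb =>
    refine fun N => ⟨N + 1, φ (fb * eb), fb_mul_eb_mem_borelAlg, ?_⟩
    have : Commute eb fb := comm_eb_fb
    rw [← map_pow, ← map_mul, (this.pow_left _).eq, pow_succ', ← mul_assoc, map_mul, map_pow]
  | hf =>
    refine fun N => ⟨N + 2, φ (f * eb ^ 2 + (N + 2) • (hb * eb)), ?_, ?_⟩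
    · rw [map_add, map_nsmul, map_mul φ hb]
      exact add_mem f_mul_eb_sq_mem_borelAlg
        (nsmul_mem (mul_mem (Algebra.subset_adjoin (by simp)) eb_mem_borelAlg) _)
    · rw [← map_pow, ← map_mul, eb_pow_succ_mul_f, pow_succ' eb N, ← mul_assoc, add_mul,
        mul_assoc f, smul_mul_assoc, ← pow_two, map_mul, map_pow]
  | hadd u v hu hv => rw [map_add]; exact add_mem hu hv
  | hmul u v hu hv => rw [map_mul]; exact mul_mem hu hv

lemma exists_eb_pow_mul_mem_borelAlg (u : U) : ∃ N : ℕ, φ eb ^ N * φ u ∈ borelAlg φ := by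
  obtain ⟨N, b, hb, h⟩ := map_mem_leftFractions (φ := φ) u 0
  exact ⟨N, by rwa [h, pow_zero, mul_one]⟩

variable (φ) in
lemma lie_map_f_map_eb_pow_succ (n : ℕ) :
    ⁅φ f, φ eb ^ (n + 1)⁆ = -((n + 1) • (φ hb * φ eb ^ n)) := by
  rw [← map_pow, map_lie, lie_f_eb_pow_succ, map_neg, map_nsmul, map_mul, map_pow]

/- Commuting `ē ^ (n + 1)` with `f` produces `h̄ ē ^ n`, and `C̄` is a combination of `h̄` and
`ē`. -/
lemma eb_pow_mul_casimirBar_mul_eq_zero {n : ℕ} {y : A} (hy : φ eb ^ (n + 1) * y = 0)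
    (hfy : φ eb ^ (n + 1) * ⁅φ f, y⁆ = 0) : φ eb ^ n * (φ casimirBar * y) = 0 := by
  have hhb : φ hb * φ eb ^ n * y = 0 := by
    have := lie_mul (φ f) (φ eb ^ (n + 1)) y
    rw [hy, hfy, lie_zero, lie_map_f_map_eb_pow_succ, add_zero, neg_mul, eq_comm, neg_eq_zero,
      smul_mul_assoc, ← Nat.cast_smul_eq_nsmul ℂ] at this
    exact (smul_eq_zero_iff_right (Nat.cast_ne_zero.2 n.succ_ne_zero)).1 this
  have hcomm : Commute (φ eb ^ n) (φ casimirBar) := (commute_map_casimirBar eb).pow_left n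
  calc φ eb ^ n * (φ casimirBar * y) = φ casimirBar * φ eb ^ n * y := by
        rw [← mul_assoc, hcomm.eq]
    _ = φ hb * (φ hb * φ eb ^ n * y) + 4 * φ fb * (φ eb ^ (n + 1) * y) := by
        simp only [casimirBar, map_add, map_mul, map_pow, map_ofNat, pow_succ' (φ eb)]
        noncomm_ring
    _ = 0 := by rw [hhb, hy, mul_zero, mul_zero, add_zero]

lemma eq_zero_of_eb_pow_mul_eq_zero (hreg : IsLeftRegular (φ casimirBar)) {S : Set A}
    (hS : ∀ y ∈ S, ⁅φ f, y⁆ ∈ S) {n : ℕ} (hn : ∀ y ∈ S, φ eb ^ n * y = 0) : ∀ y ∈ S, y = 0 := by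
  induction n with
  | zero => simpa using hn
  | succ n ih =>
    refine ih fun y hy => hreg.mul_left_eq_zero_iff.1 ?_
    have hcomm : Commute (φ casimirBar) (φ eb ^ n) :=
      ((commute_map_casimirBar eb).pow_left n).symm
    rw [← mul_assoc, hcomm.eq, mul_assoc]
    exact eb_pow_mul_casimirBar_mul_eq_zero (hn y hy) (hn _ (hS y hy))

lemma ad_f_locally_nilpotent (u : U) : ∃ k : ℕ, (ad ℂ A (φ f) ^ k) (φ u) = 0 := by
  obtain ⟨k, hk⟩ := adf_nilpotent u
  have hsemi : Function.Semiconj φ adf (ad ℂ A (φ f)) := fun u => (map_lie φ f u).symm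
  exact ⟨k, by rw [Module.End.pow_apply, ← hsemi.iterate_right k, hk, map_zero]⟩

lemma isLeftRegular_eb (hφ : Function.Surjective φ) (hreg : IsLeftRegular (φ casimirBar)) :
    IsLeftRegular (φ eb) := by
  refine isLeftRegular_iff_right_eq_zero_of_mul.2 fun x hx => ?_
  have hpow : ∀ j, φ eb ^ (j + 1) * (ad ℂ A (φ f) ^ j) x = 0 := fun j => by
    induction j with
    | zero => simpa using hx
    | succ j ih =>
      have hcomm : Commute (φ eb) (φ hb) := Commute.map comm_eb_hb φ
      have hlie := congrArg (φ eb * ·) (lie_mul (φ f) (φ eb ^ (j + 1)) ((ad ℂ A (φ f) ^ j) x))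
      simp only [ih, lie_zero, mul_zero, lie_map_f_map_eb_pow_succ, mul_add, ← mul_assoc] at hlie
      rw [mul_neg, mul_smul_comm, ← mul_assoc, hcomm.eq, mul_assoc (φ hb), ← pow_succ', neg_mul,
        smul_mul_assoc, mul_assoc, ih, mul_zero, smul_zero, neg_zero, zero_add, ← pow_succ'] at hlie
      rw [pow_succ' (ad ℂ A (φ f)), Module.End.mul_apply]
      exact hlie.symm
  obtain ⟨u, rfl⟩ := hφ x
  obtain ⟨k, hk⟩ := ad_f_locally_nilpotent (φ := φ) u
  refine eq_zero_of_eb_pow_mul_eq_zero hreg (S := Set.range fun j => (ad ℂ A (φ f) ^ j) (φ u))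
    (n := k) ?_ ?_ _ ⟨0, rfl⟩
  · rintro _ ⟨j, rfl⟩
    exact ⟨j + 1, by simp only [pow_succ', Module.End.mul_apply, LieAlgebra.ad_apply]⟩
  · rintro _ ⟨j, rfl⟩
    obtain hj | hj := lt_or_ge j k
    · rw [← Nat.sub_add_cancel hj, pow_add, mul_assoc, hpow, mul_zero]
    · obtain ⟨i, rfl⟩ := Nat.exists_eq_add_of_le' hj
      simp only [pow_add, Module.End.mul_apply, hk, map_zero, mul_zero]

lemma map_mem_center (hφ : Function.Surjective φ) {z : U} (hz : z ∈ Subalgebra.center ℂ U) :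
    φ z ∈ Subalgebra.center ℂ A := by
  refine Subalgebra.mem_center_iff.2 fun x => ?_
  obtain ⟨u, rfl⟩ := hφ x
  rw [← map_mul, Subalgebra.mem_center_iff.1 hz, map_mul]

lemma casimirAlg_le_center (hφ : Function.Surjective φ) :
    casimirAlg φ ≤ Subalgebra.center ℂ A := by
  refine Algebra.adjoin_le ?_
  rintro _ (rfl | rfl)
  exacts [map_mem_center hφ casimir_mem_center, map_mem_center hφ casimirBar_mem_center]

lemma casimirBar_mem_casimirAlg : φ casimirBar ∈ casimirAlg φ := Algebra.subset_adjoin (by simp)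

lemma lie_map_h_map_eb : ⁅φ h, φ eb⁆ = (2 : ℂ) • φ eb := by rw [map_lie, lie_h_eb, map_smul]

lemma exists_ad_pow_mem_adjoin_of_lie_eq {s : Set A} {t x : U} {u : A} {c : ℂ} (hc : c ≠ 0)
    (htx : ⁅t, x⁆ = c • eb) (hreg : IsLeftRegular (φ eb)) (hs : φ eb ∈ s)
    (hx : ∀ y ∈ s, ⁅φ x, y⁆ ∈ Algebra.adjoin ℂ s) (ht : ∀ y ∈ s, Commute (φ t) y)
    (hebs : ∀ y ∈ s, Commute (φ eb) y) (hu : u ∈ Algebra.adjoin ℂ (insert (φ x) s))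
    (hu0 : u ≠ 0) :
    ∃ m : ℕ, (ad ℂ A (φ t) ^ m) u ∈ Algebra.adjoin ℂ s ∧ (ad ℂ A (φ t) ^ m) u ≠ 0 := by
  have hτ : ⁅φ t, φ x⁆ = c • φ eb := by rw [map_lie, htx, map_smul]
  refine exists_ad_pow_mem_adjoin hx ht ?_ ?_ ?_ hu hu0 <;> rw [hτ]
  · exact Subalgebra.smul_mem _ (Algebra.subset_adjoin hs) c
  · exact fun y hy => (hebs y hy).smul_left c
  · refine isLeftRegular_iff_right_eq_zero_of_mul.2 fun y hy => hreg.mul_left_eq_zero_iff.1 ?_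
    rwa [smul_mul_assoc, smul_eq_zero_iff_right hc] at hy

/- `[ē, h]`, `[e, h̄]` and `[h̄, e]` are nonzero multiples of `ē`, so that three families of
iterated commutators remove `h`, `h̄` and `e` in turn. -/
lemma exists_ad_pow_mem_adjoin_eb (hφ : Function.Surjective φ)
    (hreg : IsLeftRegular (φ casimirBar)) {u : A} (hu : u ∈ borelAlg φ) (hu0 : u ≠ 0) :
    ∃ i j k : ℕ, (ad ℂ A (φ hb) ^ k) ((ad ℂ A (φ e) ^ j) ((ad ℂ A (φ eb) ^ i) u)) ∈
        Algebra.adjoin ℂ {φ eb, φ casimir, φ casimirBar} ∧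
      (ad ℂ A (φ hb) ^ k) ((ad ℂ A (φ e) ^ j) ((ad ℂ A (φ eb) ^ i) u)) ≠ 0 := by
  have heb := isLeftRegular_eb hφ hreg
  have hC : ∀ u, ⁅φ u, φ casimir⁆ = 0 := fun u => (commute_map_casimir u).lie_eq
  have hCb : ∀ u, ⁅φ u, φ casimirBar⁆ = 0 := fun u => (commute_map_casimirBar u).lie_eq
  have h_hb : ⁅φ h, φ hb⁆ = 0 := (Commute.map comm_h_hb φ).lie_eq
  have e_eb : Commute (φ e) (φ eb) := Commute.map comm_e_eb φ
  have eb_hb : Commute (φ eb) (φ hb) := Commute.map comm_eb_hb φ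
  have hb_e : ⁅φ hb, φ e⁆ = (2 : ℂ) • φ eb := by rw [map_lie, lie_hb_e, map_smul]
  have h_e : ⁅φ h, φ e⁆ = (2 : ℂ) • φ e := by rw [map_lie, lie_h_e, map_smul]
  have h_eb : ⁅φ h, φ eb⁆ = (2 : ℂ) • φ eb := lie_map_h_map_eb
  have hmem : ∀ {s : Set A} {a : A} (c : ℂ), a ∈ s → c • a ∈ Algebra.adjoin ℂ s :=
    fun c ha => Subalgebra.smul_mem _ (Algebra.subset_adjoin ha) c
  have comm_C : ∀ u, Commute (φ u) (φ casimir) := commute_map_casimir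
  have comm_Cb : ∀ u, Commute (φ u) (φ casimirBar) := commute_map_casimirBar
  obtain ⟨i, hi, hi0⟩ := exists_ad_pow_mem_adjoin_of_lie_eq (by norm_num) lie_eb_h heb (by simp)
    (by simp [h_hb, h_e, h_eb, hC, hCb, hmem]) (by simp [eb_hb, e_eb.symm, comm_C, comm_Cb])
    (by simp [eb_hb, e_eb.symm, comm_C, comm_Cb]) hu hu0
  obtain ⟨j, hj, hj0⟩ := exists_ad_pow_mem_adjoin_of_lie_eq (by norm_num) lie_e_hb heb (by simp)
    (by simp [hb_e, eb_hb.symm.lie_eq, hC, hCb, hmem]) (by simp [e_eb, comm_C, comm_Cb])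
    (by simp [e_eb.symm, comm_C, comm_Cb]) hi hi0
  obtain ⟨k, hk, hk0⟩ := exists_ad_pow_mem_adjoin_of_lie_eq (by norm_num) lie_hb_e heb (by simp)
    (by simp [e_eb.lie_eq, hC, hCb]) (by simp [eb_hb.symm, comm_C, comm_Cb])
    (by simp [comm_C, comm_Cb]) hj hj0
  exact ⟨i, j, k, hk, hk0⟩

lemma exists_eval_eb_eq {u : A} (hu : u ∈ Algebra.adjoin ℂ {φ eb, φ casimir, φ casimirBar}) :
    ∃ p : Polynomial A, (∀ i, p.coeff i ∈ casimirAlg φ) ∧ p.eval (φ eb) = u := by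
  refine exists_eval_eq_of_mem_adjoin_insert ?_ hu
  simp [(commute_map_casimir (φ := φ) eb).lie_eq, (commute_map_casimirBar (φ := φ) eb).lie_eq]

/- For central `z` none of the commutators of the descent changes `ē ^ N z`, and comparing weights
in `ē ^ N z = ∑ pᵢ ē ^ i` gives `z = p_N`. -/
lemma mem_casimirAlg_of_mem_center (hφ : Function.Surjective φ)
    (hreg : IsLeftRegular (φ casimirBar)) {z : A} (hz : z ∈ Subalgebra.center ℂ A) :
    z ∈ casimirAlg φ := by
  obtain rfl | hz0 := eq_or_ne z 0
  · exact zero_mem _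
  have hcomm : ∀ x, Commute x z := Subalgebra.mem_center_iff.1 hz
  have heb := isLeftRegular_eb hφ hreg
  obtain ⟨u, hu⟩ := hφ z
  obtain ⟨N, hN⟩ := exists_eb_pow_mul_mem_borelAlg (φ := φ) u
  rw [hu] at hN
  obtain ⟨i, j, k, hmem, hne⟩ := exists_ad_pow_mem_adjoin_eb hφ hreg hN
    ((heb.pow N).mul_left_eq_zero_iff.not.2 hz0)
  have hfix : ∀ {x : U}, Commute x eb → ∀ i, (ad ℂ A (φ x) ^ i) (φ eb ^ N * z) = 0 ∨
      (ad ℂ A (φ x) ^ i) (φ eb ^ N * z) = φ eb ^ N * z := fun hx =>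
    ad_pow_eq_zero_or_eq_self (((hx.map φ).pow_right N).mul_right (hcomm _))
  have hdescent : φ eb ^ N * z ∈ Algebra.adjoin ℂ {φ eb, φ casimir, φ casimirBar} := by
    rcases hfix (Commute.refl eb) i with hi | hi <;> rcases hfix comm_e_eb j with hj | hj <;>
      rcases hfix comm_eb_hb.symm k with hk | hk <;> simp_all
  obtain ⟨p, hp, hpz⟩ := exists_eval_eb_eq hdescent
  have hcoeff := coeff_mul_pow_eq_zero (p := p - Polynomial.monomial N z) two_ne_zero
    (lie_map_h_map_eb (φ := φ)) (fun i => ?_)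
    (by rw [Polynomial.eval_sub, hpz, Polynomial.eval_monomial, (hcomm _).eq, sub_self]) N
  · rw [Polynomial.coeff_sub, Polynomial.coeff_monomial, if_pos rfl,
      ← (Subalgebra.mem_center_iff.1 (sub_mem (casimirAlg_le_center hφ (hp N)) hz) _),
      (heb.pow N).mul_left_eq_zero_iff, sub_eq_zero] at hcoeff
    exact hcoeff ▸ hp N
  · rw [Polynomial.coeff_sub, Polynomial.coeff_monomial]
    refine Commute.sub_right (Subalgebra.mem_center_iff.1 (casimirAlg_le_center hφ (hp i)) _) ?_
    split_ifs
    exacts [hcomm _, Commute.zero_right _]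

lemma casimirBar_pow_mul_eq_zero {n : ℕ} {y : A} (hfy : Commute (φ f) y)
    (hy : φ eb ^ n * y = 0) : φ casimirBar ^ n * y = 0 := by
  induction n generalizing y with
  | zero => simpa using hy
  | succ n ih =>
    rw [pow_succ, mul_assoc]
    exact ih ((commute_map_casimirBar f).mul_right hfy)
      (eb_pow_mul_casimirBar_mul_eq_zero hy (by rw [hfy.lie_eq, mul_zero]))

lemma exists_mem_casimirAlg_map_eq_zero (hφ : Function.Surjective φ)
    (hreg : IsLeftRegular (φ casimirBar)) {A' : Type*} [Ring A'] [Algebra ℂ A'] (ψ : A →ₐ[ℂ] A')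
    {x : A} (hx : x ≠ 0) (hψ : ψ x = 0) : ∃ d ∈ casimirAlg φ, d ≠ 0 ∧ ψ d = 0 := by
  have hcenter : ∀ {d}, d ∈ casimirAlg φ → ∀ u, Commute (φ u) d := fun hd u =>
    Subalgebra.mem_center_iff.1 (casimirAlg_le_center hφ hd) _
  obtain ⟨u, rfl⟩ := hφ x
  obtain ⟨N, hN⟩ := exists_eb_pow_mul_mem_borelAlg (φ := φ) u
  obtain ⟨i, j, k, hmem, hne⟩ := exists_ad_pow_mem_adjoin_eb hφ hreg hN
    (((isLeftRegular_eb hφ hreg).pow N).mul_left_eq_zero_iff.not.2 hx)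
  obtain ⟨p, hp, hpw⟩ := exists_eval_eb_eq hmem
  have hψw : (p.map (ψ : A →+* A')).eval (ψ (φ eb)) = 0 := by
    refine (Polynomial.eval_map _ _).trans ((Polynomial.eval₂_at_apply (ψ : A →+* A') _).trans ?_)
    rw [hpw]
    exact map_ad_pow_eq_zero (map_ad_pow_eq_zero (map_ad_pow_eq_zero
      (by rw [map_mul, hψ, mul_zero]) _ _) _ _) _ _
  have hcoeff := coeff_mul_pow_eq_zero two_ne_zero (lie_map_h_map_eb (φ := ψ.comp φ))
    (fun m => (Polynomial.coeff_map (ψ : A →+* A') m).symm ▸ (hcenter (hp m) h).map ψ) hψw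
  obtain ⟨m, hm⟩ : ∃ m, p.coeff m ≠ 0 := by
    by_contra! h0
    exact hne (by rw [← hpw, Polynomial.ext (q := 0) h0, Polynomial.eval_zero])
  refine ⟨φ casimirBar ^ m * p.coeff m, mul_mem (pow_mem casimirBar_mem_casimirAlg m) (hp m),
    (hreg.pow m).mul_left_eq_zero_iff.not.2 hm, ?_⟩
  have hcomm : ∀ u, Commute (ψ (φ u)) (ψ (p.coeff m)) := fun u => (hcenter (hp m) u).map ψ
  rw [map_mul, map_pow]
  refine casimirBar_pow_mul_eq_zero (φ := ψ.comp φ) (hcomm f) ?_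
  simpa [((hcomm eb).pow_left m).eq] using hcoeff m

end Regular

/-! ### Central quotients of `U` -/

/-- The left ideal `U(C - a) + U(C̄ - b)`. -/
def casimirIdeal (a b : ℂ) : Ideal U :=
  Ideal.span {casimir - algebraMap ℂ U a, casimirBar - algebraMap ℂ U b}

lemma casimir_sub_mem (a b : ℂ) : casimir - algebraMap ℂ U a ∈ casimirIdeal a b :=
  Ideal.subset_span (by simp)

lemma casimirBar_sub_mem (a b : ℂ) : casimirBar - algebraMap ℂ U b ∈ casimirIdeal a b :=
  Ideal.subset_span (by simp)

instance (a b : ℂ) : (casimirIdeal a b).IsTwoSided where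
  mul_mem_of_left {x} y hx := by
    induction hx using Submodule.span_induction with
    | mem x hx =>
      have hz : x ∈ Subalgebra.center ℂ U := by
        rcases hx with rfl | rfl
        · exact sub_mem casimir_mem_center (Subalgebra.algebraMap_mem _ a)
        · exact sub_mem casimirBar_mem_center (Subalgebra.algebraMap_mem _ b)
      rw [← Subalgebra.mem_center_iff.1 hz]
      exact Ideal.mul_mem_left _ _ (Ideal.subset_span hx)
    | zero => rw [zero_mul]; exact zero_mem _
    | add u v _ _ hu hv => rw [add_mul]; exact add_mem hu hv
    | smul r u _ hu => rw [smul_eq_mul, mul_assoc]; exact Ideal.mul_mem_left _ _ hu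

/-- The quotient map onto `U / (U(C - a) + U(C̄ - b))`. -/
abbrev toQuot (a b : ℂ) : U →ₐ[ℂ] U ⧸ casimirIdeal a b := Ideal.Quotient.mkₐ ℂ (casimirIdeal a b)

lemma toQuot_eq_zero {a b : ℂ} {u : U} : toQuot a b u = 0 ↔ u ∈ casimirIdeal a b :=
  Ideal.Quotient.eq_zero_iff_mem

lemma toQuot_surjective (a b : ℂ) : Function.Surjective (toQuot a b) :=
  Ideal.Quotient.mk_surjective

lemma toQuot_casimir (a b : ℂ) : toQuot a b casimir = algebraMap ℂ _ a := by
  have := toQuot_eq_zero.2 (casimir_sub_mem a b)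
  rwa [map_sub, AlgHom.commutes, sub_eq_zero] at this

lemma toQuot_casimirBar (a b : ℂ) : toQuot a b casimirBar = algebraMap ℂ _ b := by
  have := toQuot_eq_zero.2 (casimirBar_sub_mem a b)
  rwa [map_sub, AlgHom.commutes, sub_eq_zero] at this

lemma casimirAlg_toQuot_le (a b : ℂ) : casimirAlg (toQuot a b) ≤ ⊥ := by
  refine Algebra.adjoin_le ?_
  rintro _ (rfl | rfl)
  · rw [toQuot_casimir]; exact Subalgebra.algebraMap_mem _ a
  · rw [toQuot_casimirBar]; exact Subalgebra.algebraMap_mem _ b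

lemma isLeftRegular_toQuot_casimirBar (a : ℂ) {b : ℂ} (hb : b ≠ 0) :
    IsLeftRegular (toQuot a b casimirBar) := by
  refine isLeftRegular_iff_right_eq_zero_of_mul.2 fun x hx => ?_
  rwa [toQuot_casimirBar, ← Algebra.smul_def, smul_eq_zero_iff_right hb] at hx

lemma casimirIdeal_le_ker {a b : ℂ} {A : Type*} [Ring A] [Algebra ℂ A] {ψ : U →ₐ[ℂ] A}
    (hC : ψ casimir = algebraMap ℂ A a) (hCbar : ψ casimirBar = algebraMap ℂ A b) :
    casimirIdeal a b ≤ RingHom.ker ψ := by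
  refine Ideal.span_le.2 ?_
  rintro _ (rfl | rfl) <;> simp [RingHom.mem_ker, hC, hCbar]

/- For `b ≠ 0` the algebra `U / (U(C - a) + U(C̄ - b))` is simple: a nonzero ideal contains a
nonzero polynomial in `C` and `C̄`, that is, a nonzero scalar. -/
lemma ker_eq_casimirIdeal {a b : ℂ} (hb : b ≠ 0) {A : Type*} [Ring A] [Algebra ℂ A]
    [Nontrivial A] (ψ : U →ₐ[ℂ] A) (hC : ψ casimir = algebraMap ℂ A a)
    (hCbar : ψ casimirBar = algebraMap ℂ A b) : RingHom.ker ψ = casimirIdeal a b := by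
  have hle := casimirIdeal_le_ker hC hCbar
  refine le_antisymm (fun u hu => ?_) hle
  by_contra hmem
  obtain ⟨d, hd, hd0, hψd⟩ := exists_mem_casimirAlg_map_eq_zero (toQuot_surjective a b)
    (isLeftRegular_toQuot_casimirBar a hb) (Ideal.Quotient.liftₐ _ ψ fun _ hv => hle hv)
    (x := toQuot a b u) (toQuot_eq_zero.not.2 hmem) hu
  obtain ⟨c, rfl⟩ := Algebra.mem_bot.1 (casimirAlg_toQuot_le a b hd)
  rw [AlgHom.commutes, FaithfulSMul.algebraMap_eq_zero_iff] at hψd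
  exact hd0 (by rw [hψd, map_zero])

lemma annihilator_eq_casimirIdeal {a b : ℂ} (hb : b ≠ 0) (M : Type*) [AddCommGroup M] [Module ℂ M]
    [Module U M] [IsScalarTower ℂ U M] [Nontrivial M] (hC : ∀ m : M, casimir • m = a • m)
    (hCbar : ∀ m : M, casimirBar • m = b • m) : Module.annihilator U M = casimirIdeal a b := by
  rw [← ker_eq_casimirIdeal hb (Algebra.lsmul ℂ ℂ M) (LinearMap.ext hC) (LinearMap.ext hCbar)]
  ext u
  exact Module.mem_annihilator.trans
    (LinearMap.ext_iff (f := Algebra.lsmul ℂ ℂ M u) (g := 0)).symm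

/-! ### Central characters -/

lemma toQuot_mem_bot (a : ℂ) {b : ℂ} (hb : b ≠ 0) (z : Z) : toQuot a b z ∈ (⊥ : Subalgebra ℂ _) :=
  casimirAlg_toQuot_le a b (mem_casimirAlg_of_mem_center (toQuot_surjective a b)
    (isLeftRegular_toQuot_casimirBar a hb) (map_mem_center (toQuot_surjective a b) z.2))

lemma exists_algebraMap_eq {K A B : Type*} [Field K] [Ring A] [Algebra K A] [Nontrivial A] [Ring B]
    [Algebra K B] (ψ : B →ₐ[K] A) (hψ : ∀ x, ψ x ∈ (⊥ : Subalgebra K A)) :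
    ∃ χ : B →ₐ[K] K, ∀ x, algebraMap K A (χ x) = ψ x := by
  let ι := Algebra.botEquivOfInjective (FaithfulSMul.algebraMap_injective K A)
  refine ⟨ι.toAlgHom.comp (ψ.codRestrict ⊥ hψ), fun x => ?_⟩
  exact congrArg Subtype.val ((ι.symm.commutes _).symm.trans (ι.symm_apply_apply _))

lemma exists_character (a : ℂ) {b : ℂ} (hb : b ≠ 0) [Nontrivial (U ⧸ casimirIdeal a b)] :
    ∃ χ : Z →ₐ[ℂ] ℂ, χ C = a ∧ χ Cbar = b ∧ idealOfKer χ = casimirIdeal a b := by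
  obtain ⟨χ, hχ⟩ := exists_algebraMap_eq ((toQuot a b).comp Z.val) (toQuot_mem_bot a hb)
  have hinj := FaithfulSMul.algebraMap_injective ℂ (U ⧸ casimirIdeal a b)
  have hCa : χ C = a := hinj ((hχ C).trans (toQuot_casimir a b))
  have hCb : χ Cbar = b := hinj ((hχ Cbar).trans (toQuot_casimirBar a b))
  refine ⟨χ, hCa, hCb, le_antisymm ?_ ?_⟩
  · refine Ideal.span_le.2 ?_
    rintro _ ⟨z, hz, rfl⟩
    exact toQuot_eq_zero.1 ((hχ z).symm.trans (by rw [hz, map_zero]))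
  · refine Ideal.span_le.2 ?_
    rintro x (rfl | rfl)
    · exact Ideal.subset_span ⟨C - algebraMap ℂ Z a, by simp [hCa], rfl⟩
    · exact Ideal.subset_span ⟨Cbar - algebraMap ℂ Z b, by simp [hCb], rfl⟩

lemma mul_casimirBar_pow (u : U) (k : ℕ) : u * casimirBar ^ k = casimirBar ^ k * u :=
  Subalgebra.mem_center_iff.1 (pow_mem casimirBar_mem_center k) u

/-- The ideal of elements annihilated by a power of `C̄`. -/
def casimirBarTorsion : Ideal U where
  carrier := {u | ∃ k : ℕ, casimirBar ^ k * u = 0}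
  zero_mem' := ⟨0, by simp⟩
  add_mem' := by
    rintro u v ⟨k, hk⟩ ⟨l, hl⟩
    refine ⟨k + l, ?_⟩
    rw [mul_add, pow_add, mul_assoc _ _ v, hl, ← mul_casimirBar_pow, mul_assoc, hk]
    simp
  smul_mem' := by
    rintro r u ⟨k, hk⟩
    exact ⟨k, by rw [smul_eq_mul, ← mul_assoc, ← mul_casimirBar_pow, mul_assoc, hk, mul_zero]⟩

instance : casimirBarTorsion.IsTwoSided where
  mul_mem_of_left y := by
    rintro ⟨k, hk⟩
    exact ⟨k, by rw [← mul_assoc, hk, zero_mul]⟩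

/-- The quotient map of `U` by its `C̄`-torsion. -/
abbrev toTorsionFree : U →ₐ[ℂ] U ⧸ casimirBarTorsion := Ideal.Quotient.mkₐ ℂ casimirBarTorsion

lemma toTorsionFree_eq_zero {u : U} : toTorsionFree u = 0 ↔ ∃ k : ℕ, casimirBar ^ k * u = 0 :=
  Ideal.Quotient.eq_zero_iff_mem

lemma toTorsionFree_surjective : Function.Surjective toTorsionFree := Ideal.Quotient.mk_surjective

lemma isLeftRegular_toTorsionFree_casimirBar : IsLeftRegular (toTorsionFree casimirBar) := by
  refine isLeftRegular_iff_right_eq_zero_of_mul.2 fun x hx => ?_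
  obtain ⟨u, rfl⟩ := toTorsionFree_surjective x
  rw [← map_mul, toTorsionFree_eq_zero] at hx
  obtain ⟨k, hk⟩ := hx
  exact toTorsionFree_eq_zero.2 ⟨k + 1, by rw [pow_succ, mul_assoc, hk]⟩

lemma exists_Cbar_pow_mul_eq (z : Z) :
    ∃ w ∈ Algebra.adjoin ℂ {C, Cbar}, ∃ k : ℕ, Cbar ^ k * z = Cbar ^ k * w := by
  have hmap : casimirAlg toTorsionFree =
      (Algebra.adjoin ℂ {C, Cbar}).map (toTorsionFree.comp Z.val) := by
    rw [AlgHom.map_adjoin, Set.image_pair]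
    rfl
  have hz := mem_casimirAlg_of_mem_center toTorsionFree_surjective
    isLeftRegular_toTorsionFree_casimirBar (map_mem_center toTorsionFree_surjective z.2)
  obtain ⟨w, hw, hwz⟩ := hmap ▸ hz
  have hsub : toTorsionFree (z - w : Z) = 0 := by
    rw [Subalgebra.coe_sub, map_sub, sub_eq_zero]
    exact hwz.symm
  obtain ⟨k, hk⟩ := toTorsionFree_eq_zero.1 hsub
  exact ⟨w, hw, k, sub_eq_zero.1 ((mul_sub _ _ _).symm.trans (Subtype.ext hk))⟩

lemma character_ext {χ χ' : Z →ₐ[ℂ] ℂ} (h : χ Cbar ≠ 0) (hC : χ C = χ' C)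
    (hCbar : χ Cbar = χ' Cbar) : χ = χ' := by
  ext z
  obtain ⟨w, hw, k, hk⟩ := exists_Cbar_pow_mul_eq z
  have hval : ∀ η : Z →ₐ[ℂ] ℂ, η Cbar ≠ 0 → η z = η w := by
    intro η hη
    have := congrArg η hk
    rw [map_mul, map_mul, map_pow] at this
    exact mul_left_cancel₀ (pow_ne_zero k hη) this
  rw [hval χ h, hval χ' (hCbar ▸ h)]
  refine (Algebra.adjoin_le (S := AlgHom.equalizer χ χ') ?_ : _) hw
  rintro _ (rfl | rfl)
  exacts [hC, hCbar]

/-! ### Representations of `U` and the polynomial model of Verma modules -/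

lemma sl2_induction {P : Sl2 → Prop} (he : P e₀) (hf : P f₀) (hh : P h₀)
    (add : ∀ v w, P v → P w → P (v + w)) (smul : ∀ (c : ℂ) v, P v → P (c • v)) (v : Sl2) : P v := by
  rw [sl2_eq v]
  exact add _ _ (add _ _ (smul _ _ he) (smul _ _ hf)) (smul _ _ hh)

lemma lie_map_eq_of_basis {L : Type*} [LieRing L] [LieAlgebra ℂ L] {p q r : Sl2 →ₗ[ℂ] L}
    (hbasis : ∀ v ∈ ({e₀, f₀, h₀} : Set Sl2), ∀ w ∈ ({e₀, f₀, h₀} : Set Sl2),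
      ⁅p v, q w⁆ = r ⁅v, w⁆) (v w : Sl2) : ⁅p v, q w⁆ = r ⁅v, w⁆ := by
  have hright : ∀ v ∈ ({e₀, f₀, h₀} : Set Sl2), ∀ w, ⁅p v, q w⁆ = r ⁅v, w⁆ := by
    intro v hv w
    induction w using sl2_induction with
    | he | hf | hh => exact hbasis v hv _ (by simp)
    | add w w' hw hw' => rw [map_add, lie_add, hw, hw', lie_add, map_add]
    | smul c w hw => rw [map_smul, lie_smul, hw, lie_smul, map_smul]
  induction v using sl2_induction with
  | he | hf | hh => exact hright _ (by simp) w
  | add v v' hv hv' => rw [map_add, add_lie, hv, hv', add_lie, map_add]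
  | smul c v hv => rw [map_smul, smul_lie, hv, smul_lie, map_smul]

lemma exists_linearMap_unbar_bar {M : Type*} [AddCommGroup M] [Module ℂ M] (p q : Sl2 →ₗ[ℂ] M) :
    ∃ g : T →ₗ[ℂ] M, (∀ v, g (unbar v) = p v) ∧ ∀ v, g (bar v) = q v := by
  let g : DualNumber ℂ ⊗[ℂ] Sl2 →ₗ[ℂ] M := TensorProduct.lift <|
    LinearMap.mk₂ ℂ (fun a v => a.fst • p v + a.snd • q v)
      (fun a b v => by simp only [TrivSqZeroExt.fst_add, TrivSqZeroExt.snd_add]; module)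
      (fun c a v => by
        simp only [TrivSqZeroExt.fst_smul, TrivSqZeroExt.snd_smul, smul_eq_mul]; module)
      (fun a v w => by simp only [map_add]; module)
      (fun c a v => by simp only [map_smul]; module)
  refine ⟨g, fun v => ?_, fun v => ?_⟩
  · change g ((1 : DualNumber ℂ) ⊗ₜ[ℂ] v) = _
    simp [g]
  · change g ((DualNumber.eps : DualNumber ℂ) ⊗ₜ[ℂ] v) = _
    simp [g]

lemma exists_algHom {A : Type*} [Ring A] [Algebra ℂ A] {p q : Sl2 →ₗ[ℂ] A}
    (hpp : ∀ v w, ⁅p v, p w⁆ = p ⁅v, w⁆) (hpq : ∀ v w, ⁅p v, q w⁆ = q ⁅v, w⁆)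
    (hqq : ∀ v w, ⁅q v, q w⁆ = 0) :
    ∃ φ : U →ₐ[ℂ] A, (∀ v, φ (inc (unbar v)) = p v) ∧ ∀ v, φ (inc (bar v)) = q v := by
  obtain ⟨g, hunbar, hbar⟩ := exists_linearMap_unbar_bar p q
  let G : T →ₗ⁅ℂ⁆ A :=
    { g with
      map_lie' := by
        intro x y
        change g ⁅x, y⁆ = ⁅g x, g y⁆
        obtain ⟨v, w, rfl⟩ := exists_eq x
        obtain ⟨v', w', rfl⟩ := exists_eq y
        simp only [add_lie, lie_add, map_add, ← lie_skew (bar w) (unbar v'), lie_unbar_unbar,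
          lie_unbar_bar, lie_bar_bar, map_neg, map_zero, hunbar, hbar, hpp, hqq, hpq,
          ← lie_skew (q w) (p v')] }
  exact ⟨UniversalEnvelopingAlgebra.lift ℂ G,
    fun v => (UniversalEnvelopingAlgebra.lift_ι_apply ℂ G _).trans (hunbar v),
    fun v => (UniversalEnvelopingAlgebra.lift_ι_apply ℂ G _).trans (hbar v)⟩

/-- The linear map on `sl₂` sending the standard basis to `E`, `F`, `H`. -/
def sl2Lift {M : Type*} [AddCommGroup M] [Module ℂ M] (E F H : M) : Sl2 →ₗ[ℂ] M where
  toFun v := v.1 0 1 • E + v.1 1 0 • F + v.1 0 0 • H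
  map_add' v w := by
    change (v.1 0 1 + w.1 0 1) • E + (v.1 1 0 + w.1 1 0) • F + (v.1 0 0 + w.1 0 0) • H = _
    module
  map_smul' c v := by
    change (c * v.1 0 1) • E + (c * v.1 1 0) • F + (c * v.1 0 0) • H = c • _
    module

section Sl2Lift

variable {M : Type*} [AddCommGroup M] [Module ℂ M] (E F H : M)

lemma sl2Lift_e₀ : sl2Lift E F H e₀ = E := by simp [sl2Lift, e₀]

lemma sl2Lift_f₀ : sl2Lift E F H f₀ = F := by simp [sl2Lift, f₀]

lemma sl2Lift_h₀ : sl2Lift E F H h₀ = H := by simp [sl2Lift, h₀]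

end Sl2Lift

section Model

open MvPolynomial (X pderiv)

lemma pderiv_pderiv_comm {σ R : Type*} [CommRing R] (i j : σ) (P : MvPolynomial σ R) :
    pderiv i (pderiv j P) = pderiv j (pderiv i P) := by
  classical
  have hcomm : ⁅pderiv (R := R) i, pderiv j⁆ = 0 := MvPolynomial.derivation_ext fun k => by
    rw [Derivation.commutator_apply]
    simp [MvPolynomial.pderiv_X, Pi.single_apply, apply_ite]
  exact sub_eq_zero.1 (DFunLike.congr_fun hcomm P)

/-- Multiplication by the `i`-th variable of `ℂ[x, y]`. -/
def mulX (i : Fin 2) : Module.End ℂ (MvPolynomial (Fin 2) ℂ) := LinearMap.mulLeft ℂ (X i)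

/-- The derivative of `ℂ[x, y]` in the `i`-th variable. -/
def diffX (i : Fin 2) : Module.End ℂ (MvPolynomial (Fin 2) ℂ) := (pderiv i).toLinearMap

variable (l₁ l₂ : ℂ)

/-- The action of `sl₂` on `ℂ[x, y]`, the polynomial model of the Verma module: the monomial
`x ^ i * y ^ j` stands for the image of the highest weight vector under `f̄ ^ i * f ^ j`. -/
def modelUnbar : Sl2 →ₗ[ℂ] Module.End ℂ (MvPolynomial (Fin 2) ℂ) :=
  sl2Lift
    (l₁ • diffX 1 - mulX 1 * diffX 1 * diffX 1 - (2 : ℂ) • (mulX 0 * diffX 0 * diffX 1) +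
      l₂ • diffX 0)
    (mulX 1)
    (l₁ • 1 - (2 : ℂ) • (mulX 0 * diffX 0 + mulX 1 * diffX 1))

/-- The action of the bar copy of `sl₂` on the polynomial model of the Verma module. -/
def modelBar : Sl2 →ₗ[ℂ] Module.End ℂ (MvPolynomial (Fin 2) ℂ) :=
  sl2Lift
    (l₂ • diffX 1 - mulX 0 * diffX 1 * diffX 1)
    (mulX 0)
    (l₂ • 1 - (2 : ℂ) • (mulX 0 * diffX 1))

lemma exists_model : ∃ φ : U →ₐ[ℂ] Module.End ℂ (MvPolynomial (Fin 2) ℂ),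
    (∀ v, φ (inc (unbar v)) = modelUnbar l₁ l₂ v) ∧ ∀ v, φ (inc (bar v)) = modelBar l₂ v := by
  have lie_fe : ⁅f₀, e₀⁆ = (-1 : ℂ) • h₀ := by rw [← lie_skew, lie_ef, neg_one_smul]
  have lie_eh : ⁅e₀, h₀⁆ = (-2 : ℂ) • e₀ := by rw [← lie_skew, lie_he, neg_smul]
  have lie_fh : ⁅f₀, h₀⁆ = (2 : ℂ) • f₀ := by rw [← lie_skew, lie_hf, neg_smul, neg_neg]
  have pderiv_two (i : Fin 2) : pderiv i (2 : MvPolynomial (Fin 2) ℂ) = 0 :=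
    (pderiv i).map_natCast 2
  refine exists_algHom (lie_map_eq_of_basis ?_) (lie_map_eq_of_basis ?_)
    (lie_map_eq_of_basis (r := 0) ?_)
  all_goals
    rintro _ (rfl | rfl | rfl) _ (rfl | rfl | rfl) <;> refine LinearMap.ext fun P => ?_ <;>
      simp [lie_ef, lie_fe, lie_he, lie_eh, lie_hf, lie_fh, modelUnbar, modelBar, sl2Lift_e₀,
        sl2Lift_f₀, sl2Lift_h₀, LieRing.of_associative_ring_bracket, mulX, diffX,
        MvPolynomial.smul_eq_C_mul, map_ofNat, MvPolynomial.pderiv_X,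
        pderiv_two, pderiv_pderiv_comm (1 : Fin 2) 0]
  all_goals
    ring

end Model

/-! ### Singular vectors -/

section HighestWeight

lemma e_smul_f_smul {M : Type*} [AddCommGroup M] [Module U M] (m : M) :
    e • f • m = f • e • m + h • m := by
  rw [← mul_smul, comm_ef, add_smul, mul_smul]

lemma e_smul_fb_smul {M : Type*} [AddCommGroup M] [Module U M] (m : M) :
    e • fb • m = fb • e • m + hb • m := by
  rw [← mul_smul, comm_e_fb, add_smul, mul_smul]

lemma hb_smul_fb_smul {M : Type*} [AddCommGroup M] [Module U M] (m : M) :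
    hb • fb • m = fb • hb • m := by
  rw [← mul_smul, comm_hb_fb, mul_smul]

variable {M : Type*} [AddCommGroup M] [Module ℂ M] [Module U M] [IsScalarTower ℂ U M]

lemma two_smul_smul (u : U) (m : M) : (2 * u) • m = (2 : ℂ) • u • m := by
  rw [← two_smul', smul_assoc]

lemma h_smul_f_smul (m : M) : h • f • m = f • h • m - (2 : ℂ) • f • m := by
  rw [← mul_smul, comm_hf, sub_smul, two_smul_smul, mul_smul]

lemma h_smul_fb_smul (m : M) : h • fb • m = fb • h • m - (2 : ℂ) • fb • m := by
  rw [← mul_smul, comm_h_fb, sub_smul, two_smul_smul, mul_smul]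

lemma hb_smul_f_smul (m : M) : hb • f • m = f • hb • m - (2 : ℂ) • fb • m := by
  have hbf : hb * f = f * hb - 2 * fb := by rw [comm_f_hb, add_sub_cancel_right]
  rw [← mul_smul, hbf, sub_smul, two_smul_smul, mul_smul]

variable {l₁ l₂ : ℂ} {v : M}

lemma casimir_smul (he : e • v = 0) (heb : eb • v = 0) (hh : h • v = l₁ • v)
    (hhb : hb • v = l₂ • v) : casimir • v = ((l₁ + 2) * l₂) • v := by
  have ebf : eb * f = f * eb + hb := by rw [comm_f_eb, sub_add_cancel]
  rw [casimir, ebf, add_smul, add_smul, two_smul_smul, two_smul_smul]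
  simp only [add_smul, mul_smul, he, heb, hh, hhb, smul_zero, smul_comm hb l₁]
  module

lemma casimirBar_smul (heb : eb • v = 0) (hhb : hb • v = l₂ • v) :
    casimirBar • v = l₂ ^ 2 • v := by
  rw [casimirBar, pow_two]
  simp only [add_smul, mul_smul, heb, hhb, smul_zero, smul_comm hb l₂]
  module

end HighestWeight

section Layer

variable {M : Type} [AddCommGroup M] [Module ℂ M] [Module U M]

/-- The span of the vectors `f̄ ^ i f ^ j v` with `i + j = k`; for a highest weight vector `v` this
is a weight space of the submodule generated by `v`. -/
def layer (v : M) (k : ℕ) : Submodule ℂ M :=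
  Submodule.span ℂ
    (Set.range fun p : Finset.HasAntidiagonal.antidiagonal k => fb ^ p.1.1 • f ^ p.1.2 • v)

lemma layer_le {v : M} {k : ℕ} {N : Submodule ℂ M}
    (hN : ∀ i j, i + j = k → fb ^ i • f ^ j • v ∈ N) : layer v k ≤ N := by
  refine Submodule.span_le.2 ?_
  rintro _ ⟨⟨⟨i, j⟩, hij⟩, rfl⟩
  exact hN i j (Finset.HasAntidiagonal.mem_antidiagonal.1 hij)

lemma pow_smul_pow_smul_mem_layer (v : M) {i j k : ℕ} (hij : i + j = k) :
    fb ^ i • f ^ j • v ∈ layer v k :=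
  Submodule.subset_span ⟨⟨(i, j), Finset.HasAntidiagonal.mem_antidiagonal.2 hij⟩, rfl⟩

lemma mem_layer_self (v : M) : v ∈ layer v 0 := by
  simpa only [pow_zero, one_smul] using pow_smul_pow_smul_mem_layer v (add_zero 0)

lemma layer_zero_le {v : M} {N : Submodule ℂ M} (hv : v ∈ N) : layer v 0 ≤ N :=
  layer_le fun i j hij => by
    obtain ⟨rfl, rfl⟩ : i = 0 ∧ j = 0 := by omega
    simpa only [pow_zero, one_smul] using hv

lemma layer_succ_le {v : M} {k : ℕ} {N : Submodule ℂ M} (hf : ∀ m ∈ layer v k, f • m ∈ N)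
    (hfb : ∀ m ∈ layer v k, fb • m ∈ N) : layer v (k + 1) ≤ N :=
  layer_le fun i j hij => by
    rcases i with _ | i
    · obtain rfl : j = k + 1 := by omega
      rw [pow_zero, one_smul, pow_succ', mul_smul]
      refine hf _ ?_
      simpa only [pow_zero, one_smul] using pow_smul_pow_smul_mem_layer v (zero_add k)
    · rw [pow_succ', mul_smul]
      exact hfb _ (pow_smul_pow_smul_mem_layer v (by omega))

lemma finrank_layer_le (v : M) (k : ℕ) : Module.finrank ℂ (layer v k) ≤ k + 1 :=
  (finrank_range_le_card _).trans_eq (by rw [Fintype.card_coe, Finset.Nat.card_antidiagonal])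

instance (v : M) (k : ℕ) : FiniteDimensional ℂ (layer v k) :=
  FiniteDimensional.span_of_finite ℂ (Set.finite_range _)

variable [IsScalarTower ℂ U M] {l₁ l₂ : ℂ} {v : M} {k : ℕ} {m : M}

lemma f_smul_mem_layer (hm : m ∈ layer v k) : f • m ∈ layer v (k + 1) := by
  refine (layer_le (N := (layer v (k + 1)).comap (act f)) fun i j hij => ?_) hm
  change f • fb ^ i • f ^ j • v ∈ layer v (k + 1)
  rw [← mul_smul, ((show Commute f fb from comm_f_fb).pow_right i).eq, mul_smul, ← mul_smul f,
    ← pow_succ']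
  exact pow_smul_pow_smul_mem_layer v (by omega)

lemma fb_smul_mem_layer (hm : m ∈ layer v k) : fb • m ∈ layer v (k + 1) := by
  refine (layer_le (N := (layer v (k + 1)).comap (act fb)) fun i j hij => ?_) hm
  change fb • fb ^ i • f ^ j • v ∈ layer v (k + 1)
  rw [← mul_smul, ← pow_succ']
  exact pow_smul_pow_smul_mem_layer v (by omega)

lemma h_smul_of_mem_layer (hh : h • v = l₁ • v) (hm : m ∈ layer v k) :
    h • m = (l₁ - 2 * k) • m := by
  suffices layer v k ≤ Module.End.eigenspace (act h) (l₁ - 2 * k) from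
    Module.End.mem_eigenspace_iff.1 (this hm)
  clear hm
  induction k with
  | zero =>
    refine layer_zero_le (Module.End.mem_eigenspace_iff.2 ?_)
    rw [Nat.cast_zero, mul_zero, sub_zero]
    exact hh
  | succ k ih =>
    have weight (m : M) (hm : m ∈ layer v k) : h • m = (l₁ - 2 * k) • m :=
      Module.End.mem_eigenspace_iff.1 (ih hm)
    refine layer_succ_le (fun m hm => Module.End.mem_eigenspace_iff.2 ?_)
      fun m hm => Module.End.mem_eigenspace_iff.2 ?_
    · change h • f • m = _
      rw [h_smul_f_smul, weight m hm, smul_comm f, ← sub_smul]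
      congr 1
      push_cast
      ring
    · change h • fb • m = _
      rw [h_smul_fb_smul, weight m hm, smul_comm fb, ← sub_smul]
      congr 1
      push_cast
      ring

lemma hb_smul_mem_layer (hhb : hb • v = l₂ • v) (hm : m ∈ layer v k) : hb • m ∈ layer v k := by
  suffices layer v k ≤ (layer v k).comap (act hb) from this hm
  clear hm
  induction k with
  | zero =>
    refine layer_zero_le ?_
    change hb • v ∈ layer v 0
    rw [hhb]
    exact Submodule.smul_mem _ _ (mem_layer_self v)
  | succ k ih =>
    refine layer_succ_le (fun m hm => ?_) fun m hm => ?_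
    · change hb • f • m ∈ layer v (k + 1)
      rw [hb_smul_f_smul]
      exact sub_mem (f_smul_mem_layer (ih hm)) (Submodule.smul_mem _ _ (fb_smul_mem_layer hm))
    · change hb • fb • m ∈ layer v (k + 1)
      rw [hb_smul_fb_smul]
      exact fb_smul_mem_layer (ih hm)

lemma e_smul_mem_layer (he : e • v = 0) (hh : h • v = l₁ • v) (hhb : hb • v = l₂ • v)
    (hm : m ∈ layer v (k + 1)) : e • m ∈ layer v k := by
  suffices layer v (k + 1) ≤ (layer v k).comap (act e) from this hm
  clear hm
  have key (k : ℕ) (hlow : ∀ m ∈ layer v k, f • e • m ∈ layer v k ∧ fb • e • m ∈ layer v k) :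
      layer v (k + 1) ≤ (layer v k).comap (act e) := by
    refine layer_succ_le (fun m hm => ?_) fun m hm => ?_
    · change e • f • m ∈ layer v k
      rw [e_smul_f_smul, h_smul_of_mem_layer hh hm]
      exact add_mem (hlow m hm).1 (Submodule.smul_mem _ _ hm)
    · change e • fb • m ∈ layer v k
      rw [e_smul_fb_smul]
      exact add_mem (hlow m hm).2 (hb_smul_mem_layer hhb hm)
  induction k with
  | zero =>
    refine key 0 fun m hm => ?_
    have hem : e • m = 0 := layer_zero_le (N := LinearMap.ker (act e)) he hm
    simp only [hem, smul_zero, zero_mem, and_self]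
  | succ k ih =>
    exact key (k + 1) fun m hm => ⟨f_smul_mem_layer (ih hm), fb_smul_mem_layer (ih hm)⟩

lemma exists_mem_layer_e_smul_eq_zero (he : e • v = 0) (hh : h • v = l₁ • v)
    (hhb : hb • v = l₂ • v) (hk : Module.finrank ℂ (layer v (k + 1)) = k + 2) :
    ∃ s ∈ layer v (k + 1), s ≠ 0 ∧ e • s = 0 := by
  let lower : layer v (k + 1) →ₗ[ℂ] layer v k :=
    (act e).restrict fun _ => e_smul_mem_layer he hh hhb
  have hker : LinearMap.ker lower ≠ ⊥ := LinearMap.ker_ne_bot_of_finrank_lt <| by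
    rw [hk]
    exact Nat.lt_succ_of_le (finrank_layer_le v k)
  obtain ⟨s, hs, hs0⟩ := Submodule.exists_mem_ne_zero_of_ne_bot hker
  exact ⟨s, s.2, fun h0 => hs0 (Subtype.ext h0), congrArg Subtype.val (LinearMap.mem_ker.1 hs)⟩

end Layer

/-! ### Verma modules -/

section Verma

open MvPolynomial (X)

variable (l₁ l₂ : ℂ)

/-- The highest weight vector of the Verma module. -/
def vermaVec : Verma l₁ l₂ := Submodule.Quotient.mk 1

variable {l₁ l₂}

lemma smul_vermaVec (u : U) : u • vermaVec l₁ l₂ = Submodule.Quotient.mk u := by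
  rw [vermaVec, ← Submodule.Quotient.mk_smul, smul_eq_mul, mul_one]

lemma smul_vermaVec_eq_zero {u : U} : u • vermaVec l₁ l₂ = 0 ↔ u ∈ vermaIdeal l₁ l₂ := by
  rw [smul_vermaVec, Submodule.Quotient.mk_eq_zero]

lemma exists_smul_vermaVec (m : Verma l₁ l₂) : ∃ u : U, m = u • vermaVec l₁ l₂ := by
  obtain ⟨u, rfl⟩ := Submodule.Quotient.mk_surjective _ m
  exact ⟨u, (smul_vermaVec u).symm⟩

lemma e_smul_vermaVec : e • vermaVec l₁ l₂ = 0 :=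
  smul_vermaVec_eq_zero.2 (Submodule.subset_span (by simp))

lemma eb_smul_vermaVec : eb • vermaVec l₁ l₂ = 0 :=
  smul_vermaVec_eq_zero.2 (Submodule.subset_span (by simp))

lemma h_smul_vermaVec : h • vermaVec l₁ l₂ = l₁ • vermaVec l₁ l₂ := by
  rw [← algebraMap_smul U l₁, ← sub_eq_zero, ← sub_smul]
  exact smul_vermaVec_eq_zero.2 (Submodule.subset_span (by simp))

lemma hb_smul_vermaVec : hb • vermaVec l₁ l₂ = l₂ • vermaVec l₁ l₂ := by
  rw [← algebraMap_smul U l₂, ← sub_eq_zero, ← sub_smul]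
  exact smul_vermaVec_eq_zero.2 (Submodule.subset_span (by simp))

lemma center_smul_verma {z : U} (hz : z ∈ Subalgebra.center ℂ U) {c : ℂ}
    (hzc : z • vermaVec l₁ l₂ = c • vermaVec l₁ l₂) (m : Verma l₁ l₂) : z • m = c • m := by
  obtain ⟨u, rfl⟩ := exists_smul_vermaVec m
  rw [← mul_smul, ← Subalgebra.mem_center_iff.1 hz, mul_smul, hzc, smul_comm]

lemma casimir_smul_verma (m : Verma l₁ l₂) : casimir • m = ((l₁ + 2) * l₂) • m :=
  center_smul_verma casimir_mem_center
    (casimir_smul e_smul_vermaVec eb_smul_vermaVec h_smul_vermaVec hb_smul_vermaVec) m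

lemma casimirBar_smul_verma (m : Verma l₁ l₂) : casimirBar • m = l₂ ^ 2 • m :=
  center_smul_verma casimirBar_mem_center (casimirBar_smul eb_smul_vermaVec hb_smul_vermaVec) m

lemma exists_verma_lift {N : Type*} [AddCommGroup N] [Module ℂ N] (φ : U →ₐ[ℂ] Module.End ℂ N)
    {w : N} (he : φ e w = 0) (heb : φ eb w = 0) (hh : φ h w = l₁ • w) (hhb : φ hb w = l₂ • w) :
    ∃ π : Verma l₁ l₂ →ₗ[ℂ] N, ∀ u : U, π (u • vermaVec l₁ l₂) = φ u w := by
  let ev : U →ₗ[ℂ] N := LinearMap.applyₗ w ∘ₗ φ.toLinearMap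
  have hle : (vermaIdeal l₁ l₂).restrictScalars ℂ ≤ LinearMap.ker ev := by
    intro u hu
    change φ u w = 0
    induction (hu : u ∈ vermaIdeal l₁ l₂) using Submodule.span_induction with
    | mem u hu =>
      rcases hu with rfl | rfl | rfl | rfl
      · exact he
      · exact heb
      · simp [hh]
      · simp [hhb]
    | zero => simp
    | add u u' _ _ hu hu' => rw [map_add, LinearMap.add_apply, hu, hu', add_zero]
    | smul a u _ hu => rw [smul_eq_mul, map_mul, Module.End.mul_apply, hu, map_zero]
  refine ⟨(Submodule.liftQ _ ev hle).comp
    (Submodule.Quotient.restrictScalarsEquiv ℂ (vermaIdeal l₁ l₂)).symm.toLinearMap, fun u => ?_⟩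
  rw [smul_vermaVec]
  rfl

variable (l₁ l₂)

lemma exists_verma_model : ∃ π : Verma l₁ l₂ →ₗ[ℂ] MvPolynomial (Fin 2) ℂ,
    π (vermaVec l₁ l₂) = 1 ∧ (∀ m, π (f • m) = X 1 * π m) ∧ ∀ m, π (fb • m) = X 0 * π m := by
  obtain ⟨φ, hunbar, hbar⟩ := exists_model l₁ l₂
  obtain ⟨π, hπ⟩ := exists_verma_lift (l₁ := l₁) (l₂ := l₂) φ (w := 1)
    (by rw [e, hunbar]; simp [modelUnbar, sl2Lift_e₀, diffX])
    (by rw [eb, hbar]; simp [modelBar, sl2Lift_e₀, diffX])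
    (by rw [h, hunbar]; simp [modelUnbar, sl2Lift_h₀, diffX])
    (by rw [hb, hbar]; simp [modelBar, sl2Lift_h₀, diffX])
  refine ⟨π, ?_, fun m => ?_, fun m => ?_⟩
  · rw [← one_smul U (vermaVec l₁ l₂), hπ, map_one φ, Module.End.one_apply]
  · obtain ⟨u, rfl⟩ := exists_smul_vermaVec m
    rw [← mul_smul, hπ, hπ, map_mul, Module.End.mul_apply, f, hunbar, modelUnbar, sl2Lift_f₀]
    rfl
  · obtain ⟨u, rfl⟩ := exists_smul_vermaVec m
    rw [← mul_smul, hπ, hπ, map_mul, Module.End.mul_apply, fb, hbar, modelBar, sl2Lift_f₀]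
    rfl

/-- The linear map from the Verma module to `ℂ[x, y]` sending the highest weight vector to `1` and
turning `f̄` and `f` into multiplication by `x` and `y`. -/
def vermaModel : Verma l₁ l₂ →ₗ[ℂ] MvPolynomial (Fin 2) ℂ := (exists_verma_model l₁ l₂).choose

lemma vermaModel_vermaVec : vermaModel l₁ l₂ (vermaVec l₁ l₂) = 1 :=
  (exists_verma_model l₁ l₂).choose_spec.1

variable {l₁ l₂}

lemma vermaModel_f_smul (m : Verma l₁ l₂) : vermaModel l₁ l₂ (f • m) = X 1 * vermaModel l₁ l₂ m :=
  (exists_verma_model l₁ l₂).choose_spec.2.1 m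

lemma vermaModel_fb_smul (m : Verma l₁ l₂) :
    vermaModel l₁ l₂ (fb • m) = X 0 * vermaModel l₁ l₂ m :=
  (exists_verma_model l₁ l₂).choose_spec.2.2 m

lemma vermaModel_f_pow_smul (j : ℕ) (m : Verma l₁ l₂) :
    vermaModel l₁ l₂ (f ^ j • m) = X 1 ^ j * vermaModel l₁ l₂ m := by
  induction j with
  | zero => rw [pow_zero, pow_zero, one_smul, one_mul]
  | succ j ih => rw [pow_succ', mul_smul, vermaModel_f_smul, ih, pow_succ', mul_assoc]

lemma vermaModel_fb_pow_smul (i : ℕ) (m : Verma l₁ l₂) :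
    vermaModel l₁ l₂ (fb ^ i • m) = X 0 ^ i * vermaModel l₁ l₂ m := by
  induction i with
  | zero => rw [pow_zero, pow_zero, one_smul, one_mul]
  | succ i ih => rw [pow_succ', mul_smul, vermaModel_fb_smul, ih, pow_succ', mul_assoc]

lemma vermaModel_pow_smul_pow_smul_vermaVec (i j : ℕ) :
    vermaModel l₁ l₂ (fb ^ i • f ^ j • vermaVec l₁ l₂) = X 0 ^ i * X 1 ^ j := by
  rw [vermaModel_fb_pow_smul, vermaModel_f_pow_smul, vermaModel_vermaVec, mul_one]

instance : Nontrivial (Verma l₁ l₂) :=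
  ⟨⟨vermaVec l₁ l₂, 0, fun h0 =>
    one_ne_zero (by rw [← vermaModel_vermaVec l₁ l₂, h0, map_zero])⟩⟩

lemma linearIndependent_X_pow_mul_X_pow (R : Type*) [CommSemiring R] :
    LinearIndependent R fun p : ℕ × ℕ => (X 0 ^ p.1 * X 1 ^ p.2 : MvPolynomial (Fin 2) R) := by
  have hinj : Function.Injective fun p : ℕ × ℕ =>
      (Finsupp.single (0 : Fin 2) p.1 + Finsupp.single 1 p.2 : Fin 2 →₀ ℕ) := fun p q hpq =>
    Prod.ext (by simpa using DFunLike.congr_fun hpq 0) (by simpa using DFunLike.congr_fun hpq 1)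
  convert (MvPolynomial.basisMonomials (Fin 2) R).linearIndependent.comp _ hinj using 2 with p
  simp [MvPolynomial.X_pow_eq_monomial, MvPolynomial.monomial_mul]

variable (l₁ l₂)

lemma linearIndependent_vermaModel_layer (k : ℕ) :
    LinearIndependent ℂ (vermaModel l₁ l₂ ∘ fun p : Finset.HasAntidiagonal.antidiagonal k =>
      fb ^ p.1.1 • f ^ p.1.2 • vermaVec l₁ l₂) := by
  have hmonomial : (vermaModel l₁ l₂ ∘ fun p : Finset.HasAntidiagonal.antidiagonal k =>
      fb ^ p.1.1 • f ^ p.1.2 • vermaVec l₁ l₂) = fun p => X 0 ^ p.1.1 * X 1 ^ p.1.2 :=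
    funext fun p => vermaModel_pow_smul_pow_smul_vermaVec p.1.1 p.1.2
  rw [hmonomial]
  exact (linearIndependent_X_pow_mul_X_pow ℂ).comp _ Subtype.val_injective

lemma finrank_layer_vermaVec (k : ℕ) : Module.finrank ℂ (layer (vermaVec l₁ l₂) k) = k + 1 := by
  rw [layer, finrank_span_eq_card (linearIndependent_vermaModel_layer l₁ l₂ k).of_comp,
    Fintype.card_coe, Finset.Nat.card_antidiagonal]

variable {l₁ l₂}

lemma isHomogeneous_vermaModel {k : ℕ} {s : Verma l₁ l₂} (hs : s ∈ layer (vermaVec l₁ l₂) k) :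
    (vermaModel l₁ l₂ s).IsHomogeneous k := by
  refine (layer_le (N := (MvPolynomial.homogeneousSubmodule (Fin 2) ℂ k).comap (vermaModel l₁ l₂))
    fun i j hij => ?_) hs
  change (vermaModel l₁ l₂ _).IsHomogeneous k
  rw [vermaModel_pow_smul_pow_smul_vermaVec, ← hij]
  exact (MvPolynomial.isHomogeneous_X_pow 0 i).mul (MvPolynomial.isHomogeneous_X_pow 1 j)

lemma f_pow_smul_ne_of_mem_layer {k N : ℕ} (hkN : k < N) {s : Verma l₁ l₂}
    (hs : s ∈ layer (vermaVec l₁ l₂) k) (hs0 : s ≠ 0) (j : ℕ) (m : Verma l₁ l₂) :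
    f ^ j • s ≠ f ^ j • f ^ N • m := by
  intro heq
  have hPs : vermaModel l₁ l₂ s ≠ 0 := fun h0 => hs0 <| (Submodule.disjoint_def.1
    (Submodule.range_ker_disjoint (linearIndependent_vermaModel_layer l₁ l₂ k))) s hs h0
  have hdvd : vermaModel l₁ l₂ s = X 1 ^ N * vermaModel l₁ l₂ m :=
    mul_left_cancel₀ (pow_ne_zero j (MvPolynomial.X_ne_zero 1)) <| by
      rw [← vermaModel_f_pow_smul, ← vermaModel_f_pow_smul, ← vermaModel_f_pow_smul, heq]
  have hPm : vermaModel l₁ l₂ m ≠ 0 := right_ne_zero_of_mul (hdvd ▸ hPs)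
  have hdeg : k = N + (vermaModel l₁ l₂ m).totalDegree := by
    rw [← (isHomogeneous_vermaModel hs).totalDegree hPs, hdvd,
      MvPolynomial.totalDegree_mul_of_isDomain (pow_ne_zero N (MvPolynomial.X_ne_zero 1)) hPm,
      MvPolynomial.totalDegree_X_pow]
  omega

end Verma

/-! ### The localization at `f` -/

lemma f_pow_succ_mul_e (N : ℕ) : f ^ (N + 1) * e = (f * e - N * (h + (N + 1))) * f ^ N := by
  have hfh : f * h = h * f + 2 * f := by rw [comm_hf, sub_add_cancel]
  have hfe : f * e = e * f - h := by rw [comm_ef, add_sub_cancel_right]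
  induction N with
  | zero => simp
  | succ N ih =>
    have shift : f * (f * e - N * (h + (N + 1))) =
        (f * e - (N + 1 : ℕ) * (h + ((N + 1 : ℕ) + 1))) * f := by
      have hffe : f * (f * e) = f * e * f - (h * f + 2 * f) := by
        rw [hfe, mul_sub, hfh, ← hfe]; simp only [mul_assoc]
      rw [mul_sub, hffe, ← (Nat.cast_commute N f).left_comm, mul_add f, hfh, mul_add f, mul_one,
        ← (Nat.cast_commute N f).eq]
      push_cast
      noncomm_ring
    rw [pow_succ', mul_assoc, ih, ← mul_assoc, shift, mul_assoc, ← pow_succ']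

section Loc

variable {M : Type} [AddCommGroup M] [Module U M]

lemma f_pow_smul_oreDiv (m : M) (N : ℕ) :
    f ^ N • (OreLocalization.oreDiv m (⟨f ^ N, N, rfl⟩ : Submonoid.powers f) : Loc M) =
      OreLocalization.oreDiv m 1 := by
  rw [← OreLocalization.oreDiv_one_smul]
  exact OreLocalization.smul_cancel (s := (⟨f ^ N, N, rfl⟩ : Submonoid.powers f))

lemma eq_zero_of_f_pow_smul_eq_zero {x : Loc M} (N : ℕ) (hx : f ^ N • x = 0) : x = 0 := by
  let s : Submonoid.powers f := ⟨f ^ N, N, rfl⟩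
  have hinv : OreLocalization.oreDiv (1 : U) s *
      OreLocalization.oreDiv (f ^ N) (1 : Submonoid.powers f) = 1 :=
    OreLocalization.mul_inv 1 s
  rw [← OreLocalization.oreDiv_one_smul] at hx
  rw [← one_smul (OreLocalization (Submonoid.powers f) U) x, ← hinv, mul_smul, hx, smul_zero]

lemma exists_f_pow_smul_eq_of_toLoc_eq {m m' : M} (hm : toLoc M m = toLoc M m') :
    ∃ j : ℕ, f ^ j • m = f ^ j • m' := by
  obtain ⟨⟨_, j, rfl⟩, w, hsmul, hw⟩ := OreLocalization.oreDiv_eq_iff.1 hm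
  simp only [OneMemClass.coe_one, mul_one] at hw
  rw [← hw] at hsmul
  exact ⟨j, hsmul.symm⟩

lemma exists_f_pow_smul_eq_toLoc (x : Loc M) : ∃ (N : ℕ) (m : M), f ^ N • x = toLoc M m := by
  induction x using OreLocalization.ind with
  | _ m s =>
    obtain ⟨_, N, rfl⟩ := s
    exact ⟨N, m, f_pow_smul_oreDiv m N⟩

variable [Module ℂ M] [IsScalarTower ℂ U M]

lemma center_smul_loc {z : U} (hz : z ∈ Subalgebra.center ℂ U) {c : ℂ}
    (hzc : ∀ m : M, z • m = c • m) (x : Loc M) : z • x = c • x := by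
  obtain ⟨N, m, hm⟩ := exists_f_pow_smul_eq_toLoc x
  have hz' : z - algebraMap ℂ U c ∈ Subalgebra.center ℂ U :=
    sub_mem hz (Subalgebra.algebraMap_mem _ c)
  rw [← sub_eq_zero, ← algebraMap_smul U c x, ← sub_smul]
  refine eq_zero_of_f_pow_smul_eq_zero N ?_
  rw [← mul_smul, Subalgebra.mem_center_iff.1 hz', mul_smul, hm, ← map_smul, sub_smul, hzc,
    algebraMap_smul, sub_self, map_zero]

lemma center_smul_enAr {z : U} (hz : z ∈ Subalgebra.center ℂ U) {c : ℂ}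
    (hzc : ∀ m : M, z • m = c • m) (x : EnAr M) : z • x = c • x := by
  obtain ⟨x, hx⟩ := x
  refine Subtype.ext ?_
  change z • x = c • x
  obtain ⟨y, rfl⟩ := Submodule.Quotient.mk_surjective _ x
  rw [← Submodule.Quotient.mk_smul, center_smul_loc hz hzc]
  rfl

lemma isLocallyFinite_of_e_smul_eq_zero {m : M} (hm : e • m = 0) : IsLocallyFinite m := by
  rw [isLocallyFinite_iff]
  refine ⟨Submodule.span ℂ {m}, inferInstance, Submodule.mem_span_singleton_self m, ?_⟩
  intro w hw
  obtain ⟨c, rfl⟩ := Submodule.mem_span_singleton.1 hw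
  rw [smul_comm, hm, smul_zero]
  exact zero_mem _

lemma e_smul_eq_zero_of_f_pow_smul_eq {N : ℕ} {s : M} (he : e • s = 0)
    (hh : h • s = (-(N + 1) : ℂ) • s) {x : Loc M} (hx : f ^ N • x = toLoc M s) : e • x = 0 := by
  have hweight : (h + (N + 1)) • s = 0 := by
    have hcast : ((N : U) + 1) • s = ((N : ℂ) + 1) • s := by
      rw [← algebraMap_smul U ((N : ℂ) + 1), map_add, map_natCast, map_one]
    rw [add_smul, hcast, hh, ← add_smul, neg_add_cancel, zero_smul]
  refine eq_zero_of_f_pow_smul_eq_zero (N + 1) ?_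
  rw [← mul_smul, f_pow_succ_mul_e, mul_smul, hx, ← map_smul, sub_smul, mul_smul, mul_smul,
    hweight, he, smul_zero, smul_zero, sub_zero, map_zero]

lemma nontrivial_enAr {N : ℕ} {s : M} (he : e • s = 0) (hh : h • s = (-(N + 1) : ℂ) • s)
    (hndvd : ∀ (j : ℕ) (m : M), f ^ j • s ≠ f ^ j • f ^ N • m) : Nontrivial (EnAr M) := by
  let x : Loc M := OreLocalization.oreDiv s (⟨f ^ N, N, rfl⟩ : Submonoid.powers f)
  have hx : f ^ N • x = toLoc M s := f_pow_smul_oreDiv s N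
  let y : Twist M := Submodule.Quotient.mk x
  have hy : y ≠ 0 := fun h0 => by
    obtain ⟨m, hm⟩ := (Submodule.Quotient.mk_eq_zero _).1 h0
    rw [← hm, ← map_smul] at hx
    obtain ⟨j, hj⟩ := exists_f_pow_smul_eq_of_toLoc_eq hx
    exact hndvd j m hj.symm
  have hey : e • y = 0 := by
    rw [← Submodule.Quotient.mk_smul, e_smul_eq_zero_of_f_pow_smul_eq he hh hx]
    rfl
  exact ⟨⟨⟨y, isLocallyFinite_of_e_smul_eq_zero hey⟩, 0, fun h0 => hy (congrArg Subtype.val h0)⟩⟩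

end Loc

/-! ### Annihilators -/

instance nontrivial_V (n : ℤ) (l : ℂ) : Nontrivial (V n l) := by
  obtain ⟨k, hk⟩ : ∃ k : ℕ, n ≤ k := ⟨n.toNat, n.self_le_toNat⟩
  obtain ⟨N, hN⟩ : ∃ N : ℕ, (N : ℤ) = 2 * k + 3 - n := ⟨(2 * k + 3 - n).toNat, by omega⟩
  obtain ⟨s, hs, hs0, hes⟩ := exists_mem_layer_e_smul_eq_zero e_smul_vermaVec h_smul_vermaVec
    hb_smul_vermaVec (finrank_layer_vermaVec ((n : ℂ) - 2) l (k + 1))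
  refine nontrivial_enAr (N := N) hes ?_ (f_pow_smul_ne_of_mem_layer (by omega) hs hs0)
  have hNn : (N : ℂ) = 2 * k + 3 - n := by exact_mod_cast hN
  rw [h_smul_of_mem_layer h_smul_vermaVec hs, hNn]
  congr 1
  push_cast
  ring

lemma annihilator_verma (l₁ : ℂ) {l₂ : ℂ} (hl₂ : l₂ ≠ 0) :
    Module.annihilator U (Verma l₁ l₂) = casimirIdeal ((l₁ + 2) * l₂) (l₂ ^ 2) :=
  annihilator_eq_casimirIdeal (pow_ne_zero 2 hl₂) _ casimir_smul_verma casimirBar_smul_verma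

lemma annihilator_V (n : ℤ) {l : ℂ} (hl : l ≠ 0) :
    Module.annihilator U (V n l) = casimirIdeal (n * l) (l ^ 2) := by
  refine annihilator_eq_casimirIdeal (pow_ne_zero 2 hl) _
    (center_smul_enAr casimir_mem_center fun m => ?_)
    (center_smul_enAr casimirBar_mem_center casimirBar_smul_verma)
  rw [casimir_smul_verma, sub_add_cancel]

lemma nontrivial_quotient_casimirIdeal (n : ℤ) {l : ℂ} (hl : l ≠ 0) :
    Nontrivial (U ⧸ casimirIdeal (n * l) (l ^ 2)) := by
  rw [Ideal.Quotient.nontrivial_iff, ← annihilator_V n hl]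
  exact mt Module.annihilator_eq_top_iff.1 (not_subsingleton _)

end TakiffSl2

end

theorem theorem4p23 (n : ℤ) (lam₂ : ℂ) (hlam₂ : lam₂ ≠ 0) :
    Module.annihilator TakiffSl2.U (TakiffSl2.V n lam₂) =
        Module.annihilator TakiffSl2.U (TakiffSl2.Verma ((n : ℂ) - 2) lam₂) ∧
      Module.annihilator TakiffSl2.U (TakiffSl2.V n lam₂) =
        Module.annihilator TakiffSl2.U (TakiffSl2.Verma (-(n : ℂ) - 2) (-lam₂)) ∧
      (∃! χ : TakiffSl2.Z →ₐ[ℂ] ℂ,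
        χ TakiffSl2.C = (n : ℂ) * lam₂ ∧ χ TakiffSl2.Cbar = lam₂ ^ 2) ∧
      (∀ χ : TakiffSl2.Z →ₐ[ℂ] ℂ,
        χ TakiffSl2.C = (n : ℂ) * lam₂ → χ TakiffSl2.Cbar = lam₂ ^ 2 →
          Module.annihilator TakiffSl2.U (TakiffSl2.V n lam₂) = TakiffSl2.idealOfKer χ) ∧
      Module.annihilator TakiffSl2.U (TakiffSl2.V n lam₂) =
        Ideal.span {TakiffSl2.casimir - algebraMap ℂ TakiffSl2.U ((n : ℂ) * lam₂),
          TakiffSl2.casimirBar - algebraMap ℂ TakiffSl2.U (lam₂ ^ 2)} := by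
  have hV := TakiffSl2.annihilator_V n hlam₂
  have := TakiffSl2.nontrivial_quotient_casimirIdeal n hlam₂
  have hsq : lam₂ ^ 2 ≠ 0 := pow_ne_zero 2 hlam₂
  obtain ⟨χ₀, hC, hCbar, hker⟩ := TakiffSl2.exists_character ((n : ℂ) * lam₂) hsq
  have huniq : ∀ χ : TakiffSl2.Z →ₐ[ℂ] ℂ, χ TakiffSl2.C = (n : ℂ) * lam₂ →
      χ TakiffSl2.Cbar = lam₂ ^ 2 → χ = χ₀ := fun χ h1 h2 =>
    TakiffSl2.character_ext (by rw [h2]; exact hsq) (h1.trans hC.symm) (h2.trans hCbar.symm)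
  refine ⟨?_, ?_, ⟨χ₀, ⟨hC, hCbar⟩, fun χ hχ => huniq χ hχ.1 hχ.2⟩, fun χ h1 h2 => ?_, hV⟩
  · rw [hV, TakiffSl2.annihilator_verma _ hlam₂, sub_add_cancel]
  · rw [hV, TakiffSl2.annihilator_verma _ (neg_ne_zero.2 hlam₂), sub_add_cancel, neg_mul_neg,
      neg_sq]
  · rw [hV, huniq χ h1 h2, hker]
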